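/- **Setting.** An additive noise $L$-unicast wireless network consists of a finite directed graph $(V,E)$, a real gain $h_{u,v}$ for each edge, and $2L$ distinct nodes $s_1,\dots,s_L,d_1,\dots,d_L\in V$ (sources and destinations). At time $t$ node $v$ receives $Y_v[t]=\sum_{u:(u,v)\in E}h_{u,v}X_u[t]+N_v[t]$, where $X_u[t]$ is the signal transmitted by $u$ and the noises $N_v[t]$ are real, independent over nodes and times, identically distributed over time, independent of the messages, with mean $0$ and variance $\sigma_v^2<\infty$. If all noises are $\mathcal N(0,\sigma_v^2)$, the network is an AWGN network. A coding scheme with block length $n$ and rate tuple $\vec R=(R_1,\dots,R_L)\in\mathbb R^L$ consists of encoding functions $f_i:\{1,\dots,\lfloor 2^{nR_i}\rfloor\}\to\mathbb R^n$ for the sources, (measurable) relaying functions $r_v^{(t)}$, $0\le t\le n-1$, giving the signal $X_v[t]=r_v^{(t)}(Y_v[0],\dots,Y_v[t-1])$ of every node $v$ that is not a source, and (measurable) decoding functions $g_i:\mathbb R^n\to\{1,\dots,\lfloor 2^{nR_i}\rfloor\}$ for the destinations; the average power over the block is at most $P$ for every codeword, and for every non-source node whatever it receives. Its error probability is the probability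 that $g_i(Y_{d_i}[0],\dots,Y_{d_i}[n-1])\neq W_i$ for some $i$, the messages $W_i$ being independent and uniform. A sequence $(\mathcal C_n)_{n\ge1}$ of coding schemes, $\mathcal C_n$ with block length $n$ and rate tuple $\vec R$, achieves $\vec R$ if the error probability of $\mathcal C_n$ tends to $0$. A coding scheme has finite reading precision $\rho\in\{1,2,\dots\}$ if its relaying and decoding functions do not change when each received signal $y$ is replaced by $2^{-\rho}\lfloor 2^{\rho}y\rfloor$. **Theorem.** Suppose that $\vec R$ is achieved on an AWGN $L$-unicast wireless network with noise variances $\sigma_v^2$ by a sequence of coding schemes $\mathcal C_n$, each of some finite reading precision $\rho_n$ ($\rho_n$ may vary arbitrarily with $n$). Then for every $\varepsilon>0$ there are a rate tuple $\vec R'$ with $|R'_i-R_i|<\varepsilon$ for all $i$ and a single sequence of coding schemes with rate tuple $\vec R'$ (not necessarily of finite reading precision) which, on the same network with the same power constraint, achieves $\vec R'$ for every choice of the distributions of the noises $N_v$, $v\in V$, with $E[N_v]=0$ and $E[N_v^2]=\sigma_v^2$. -/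

import Mathlib

open MeasureTheory ProbabilityTheory Filter Topology
open scoped NNReal

/-- An `L`-unicast wireless network on the node set `V`: a directed graph, a real channel gain for
each edge (the values of `gain` at non-edges are never used), `L` sources and `L` destinations,
all `2 * L` of them distinct nodes. -/
structure UnicastNetwork (V : Type*) (L : ℕ) where
  /-- The directed graph; `graph.Adj u v` says that `(u, v)` is an edge. -/
  graph : Digraph V
  /-- `gain u v` is the channel gain from `u` to `v`. -/
  gain : V → V → ℝ
  /-- The source nodes. -/
  src : Fin L → V
  /-- The destination nodes. -/
  dst : Fin L → V
  src_injective : Function.Injective src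
  dst_injective : Function.Injective dst
  src_ne_dst : ∀ i j, src i ≠ dst j

/-- The nodes that are not sources (destinations are among them). -/
abbrev UnicastNetwork.NonSource {V : Type*} {L : ℕ} (N : UnicastNetwork V L) : Type _ :=
  {v : V // v ∉ Set.range N.src}

/-- The message set `{1, …, 2 ^ (n r)}`: there are `⌊2 ^ (n r)⌋` messages. -/
abbrev MessageSet (n : ℕ) (r : ℝ) : Type := Fin ⌊(2 : ℝ) ^ ((n : ℝ) * r)⌋₊

/-- The first `t` entries of a block of length `n`. -/
def pastOf {n : ℕ} (y : Fin n → ℝ) (t : Fin n) : Fin (t : ℕ) → ℝ :=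
  fun s => y (Fin.castLE t.isLt.le s)

/-- Coding schemes with block length `n` and rate tuple `R`, under the average power constraint `P`.
The relaying function at time `t` sees the signals received at the times `0, …, t - 1`. -/
structure CodingScheme {V : Type*} {L : ℕ} (N : UnicastNetwork V L) (P : ℝ) (n : ℕ)
    (R : Fin L → ℝ) where
  /-- The encoding functions of the sources. -/
  enc : (i : Fin L) → MessageSet n (R i) → Fin n → ℝ
  /-- The relaying functions of all nodes that are not sources. -/
  relay : N.NonSource → (t : Fin n) → (Fin (t : ℕ) → ℝ) → ℝ
  /-- The decoding functions of the destinations. -/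
  dec : (i : Fin L) → (Fin n → ℝ) → MessageSet n (R i)
  enc_power : ∀ (i : Fin L) (w : MessageSet n (R i)),
    (1 / (n : ℝ)) * ∑ t : Fin n, (enc i w t) ^ 2 ≤ P
  relay_power : ∀ (v : N.NonSource) (y : Fin n → ℝ),
    (1 / (n : ℝ)) * ∑ t : Fin n, (relay v t (pastOf y t)) ^ 2 ≤ P
  relay_measurable : ∀ (v : N.NonSource) (t : Fin n), Measurable (relay v t)
  dec_measurable : ∀ i : Fin L, Measurable (dec i)

/-- The truncation `⌊x⌋_ρ = 2 ^ (-ρ) * ⌊2 ^ ρ * x⌋` to `ρ` binary digits. -/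
noncomputable def truncate (ρ : ℕ) (x : ℝ) : ℝ := ((2 : ℝ) ^ ρ)⁻¹ * (⌊(2 : ℝ) ^ ρ * x⌋ : ℝ)

/-- The law of the additive noise over a block of length `n`, when `ν v` is the law of the noise at
node `v`: the noise variables of distinct (node, time) pairs are independent. -/
noncomputable def noiseLaw {V : Type*} [Fintype V] (ν : V → Measure ℝ) (n : ℕ) :
    Measure (V × Fin n → ℝ) :=
  Measure.pi (fun p => ν p.1)

/-- `ν` is a probability law on `ℝ` with mean zero and (finite) variance `s`. -/
structure IsNoiseLaw (ν : Measure ℝ) (s : ℝ≥0) : Prop where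
  isProbabilityMeasure : IsProbabilityMeasure ν
  memLp : MemLp (fun x : ℝ => x) 2 ν
  mean_eq_zero : ∫ x, x ∂ν = 0
  second_moment_eq : ∫ x, x ^ 2 ∂ν = (s : ℝ)

namespace CodingScheme

variable {V : Type*} {L : ℕ} {N : UnicastNetwork V L} {P : ℝ} {n : ℕ} {R : Fin L → ℝ}

open scoped Classical in
/-- The signal that node `u` transmits at time `t`, when the messages are `w` and the signals
received by `u` before time `t` are `past`. -/
noncomputable def transmit (C : CodingScheme N P n R) (w : (i : Fin L) → MessageSet n (R i))
    (u : V) (t : Fin n) (past : Fin (t : ℕ) → ℝ) : ℝ :=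
  if h : u ∈ Set.range N.src then C.enc h.choose (w h.choose) t else C.relay ⟨u, h⟩ t past

open scoped Classical in
/-- The signal that node `v` receives at time `t`, when the messages are `w` and the noise
realization over the block is `z`. -/
noncomputable def receivedAt [Fintype V] (C : CodingScheme N P n R)
    (w : (i : Fin L) → MessageSet n (R i)) (z : V × Fin n → ℝ) (t : ℕ) (ht : t < n) (v : V) : ℝ :=
  (∑ u : V with N.graph.Adj u v,
    N.gain u v * C.transmit w u ⟨t, ht⟩
      (fun s : Fin t => receivedAt C w z s (s.isLt.trans ht) u)) + z (v, ⟨t, ht⟩)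
termination_by t
decreasing_by exact s.isLt

/-- The block of signals received by node `v`. -/
noncomputable def received [Fintype V] (C : CodingScheme N P n R)
    (w : (i : Fin L) → MessageSet n (R i)) (z : V × Fin n → ℝ) (v : V) : Fin n → ℝ :=
  fun t => C.receivedAt w z t t.isLt v

open scoped Classical in
/-- The channel model: the received signal is the sum of the transmit signals of the in-neighbours,
scaled by the channel gains, and of the noise. -/
theorem received_eq [Fintype V] (C : CodingScheme N P n R)
    (w : (i : Fin L) → MessageSet n (R i)) (z : V × Fin n → ℝ) (v : V) (t : Fin n) :
    C.received w z v t = (∑ u : V with N.graph.Adj u v,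
      N.gain u v * C.transmit w u t (pastOf (C.received w z u) t)) + z (v, t) := by
  unfold received
  rw [receivedAt]
  rfl

/-- The noise realizations for which some destination decodes incorrectly, for given messages. -/
def errorSet [Fintype V] (C : CodingScheme N P n R) (w : (i : Fin L) → MessageSet n (R i)) :
    Set (V × Fin n → ℝ) :=
  {z | ∃ i : Fin L, w i ≠ C.dec i (C.received w z (N.dst i))}

/-- The error probability when the noise at node `v` has law `ν v` and the messages are independent
of the noise, independent of each other, and uniformly distributed. -/
noncomputable def errorProb [Fintype V] (C : CodingScheme N P n R) (ν : V → Measure ℝ) : ℝ :=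
  (∑ w : (i : Fin L) → MessageSet n (R i), (noiseLaw ν n).real (C.errorSet w)) /
    (Fintype.card ((i : Fin L) → MessageSet n (R i)) : ℝ)

/-- All relaying and decoding functions read the received signals only up to `ρ` binary digits. -/
def HasReadingPrecision (C : CodingScheme N P n R) (ρ : ℕ) : Prop :=
  (∀ (v : N.NonSource) (t : Fin n) (y : Fin (t : ℕ) → ℝ),
    C.relay v t y = C.relay v t (fun s => truncate ρ (y s))) ∧
  (∀ (i : Fin L) (y : Fin n → ℝ), C.dec i y = C.dec i (fun s => truncate ρ (y s)))

end CodingScheme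

/-- The sequence of coding schemes `C 1, C 2, …`, where `C n` has block length `n` and rate tuple
`R`, achieves `R` when the noise at each node `v` has law `ν v`. -/
def Achieves {V : Type*} [Fintype V] {L : ℕ} {N : UnicastNetwork V L} {P : ℝ} {R : Fin L → ℝ}
    (C : (n : ℕ+) → CodingScheme N P n R) (ν : V → Measure ℝ) : Prop :=
  Tendsto (fun n : ℕ+ => (C n).errorProb ν) atTop (𝓝 0)

/-- The rate tuple `R` is achievable by coding schemes with finite reading precision; the precision
may vary arbitrarily along the sequence. -/
def AchievableWithFinitePrecision {V : Type*} [Fintype V] {L : ℕ} (N : UnicastNetwork V L) (P : ℝ)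
    (ν : V → Measure ℝ) (R : Fin L → ℝ) : Prop :=
  ∃ (C : (n : ℕ+) → CodingScheme N P n R) (ρ : ℕ+ → ℕ),
    (∀ n, 0 < ρ n ∧ (C n).HasReadingPrecision (ρ n)) ∧ Achieves C ν

/-- The noise laws of the AWGN network with noise variances `σsq v`. -/
noncomputable def awgn {V : Type*} (σsq : V → ℝ≥0) : V → Measure ℝ :=
  fun v => gaussianReal 0 (σsq v)

/-
The convergence of a normalized sum to a Gaussian is not uniform over the noise laws, whereas a
single coding scheme has to serve all of them. So the block length `n` of the given scheme is fixed
once its AWGN error probability is tiny, and many copies of that one scheme are run. The copies come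
in groups of `b`, and each group is mixed by an orthogonal matrix with entries `± b ^ (-1/2)`, which
every node applies to what it transmits and inverts on what it receives. Each copy then sees the
original network with noises that are, by the central limit theorem, approximately Gaussian when `b`
is large; finite reading precision makes the error probability continuous along this convergence, so
for every noise law the copies eventually fail with tiny probability.

An outer code over the copies corrects a constant fraction of failed copies at a small loss of rate.
Its codeword symbols are pairwise independent and uniform, and different groups see independent
noise, so by Chebyshev's inequality the number of failed copies is rarely above the correctable
fraction: with `k` groups the probability of failure is `O(1 / k)`.
-/

open scoped BigOperators Finset Matrix

lemma norm_prod_sub_prod_le {ι R : Type*} [NormedCommRing R] [NormOneClass R] (F : Finset ι)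
    {a c : ι → R} (ha : ∀ i ∈ F, ‖a i‖ ≤ 1) (hc : ∀ i ∈ F, ‖c i‖ ≤ 1) :
    ‖∏ i ∈ F, a i - ∏ i ∈ F, c i‖ ≤ ∑ i ∈ F, ‖a i - c i‖ := by
  classical
  induction F using Finset.induction_on with
  | empty => simp
  | insert i F hi ih =>
    simp only [Finset.forall_mem_insert] at ha hc
    rw [Finset.prod_insert hi, Finset.prod_insert hi, Finset.sum_insert hi]
    have hprod : ‖∏ i ∈ F, c i‖ ≤ 1 :=
      (Finset.norm_prod_le _ _).trans (Finset.prod_le_one (fun _ _ => norm_nonneg _) hc.2)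
    calc ‖a i * ∏ i ∈ F, a i - c i * ∏ i ∈ F, c i‖
        = ‖a i * (∏ i ∈ F, a i - ∏ i ∈ F, c i) + (a i - c i) * ∏ i ∈ F, c i‖ := by ring_nf
      _ ≤ ‖a i‖ * ‖∏ i ∈ F, a i - ∏ i ∈ F, c i‖ + ‖a i - c i‖ * ‖∏ i ∈ F, c i‖ :=
          (norm_add_le _ _).trans (add_le_add (norm_mul_le _ _) (norm_mul_le _ _))
      _ ≤ 1 * ∑ i ∈ F, ‖a i - c i‖ + ‖a i - c i‖ * 1 := by
          gcongr
          exacts [ha.1, ih ha.2 hc.2]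
      _ = ‖a i - c i‖ + ∑ i ∈ F, ‖a i - c i‖ := by ring

/-- The law of `∑ j, a j * Z j` for independent random variables `Z j` of law `ν`. -/
noncomputable def weightedSumLaw {ι : Type*} [Fintype ι] (ν : Measure ℝ) (a : ι → ℝ) : Measure ℝ :=
  (Measure.pi fun _ : ι => ν).map fun z => ∑ j, a j * z j

section WeightedSumLaw

variable {ι : Type*} [Fintype ι]

instance (ν : Measure ℝ) [IsProbabilityMeasure ν] (a : ι → ℝ) :
    IsProbabilityMeasure (weightedSumLaw ν a) :=
  Measure.isProbabilityMeasure_map (Measurable.aemeasurable (by fun_prop))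

lemma charFun_weightedSumLaw (ν : Measure ℝ) [IsProbabilityMeasure ν] (a : ι → ℝ) (t : ℝ) :
    charFun (weightedSumLaw ν a) t = ∏ j, charFun ν (a j * t) := by
  have hind : iIndepFun (fun (j : ι) (z : ι → ℝ) => a j * z j) (Measure.pi fun _ : ι => ν) :=
    iIndepFun_pi (X := fun j x => a j * x) fun j => by fun_prop
  rw [weightedSumLaw, hind.charFun_map_fun_sum_eq_prod
    fun j => ((measurable_pi_apply j).const_mul _).aemeasurable, Finset.prod_apply]
  refine Finset.prod_congr rfl fun j _ => ?_
  rw [charFun_map_mul_comp (measurable_pi_apply j).aemeasurable,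
    (measurePreserving_eval _ j).map_eq]

lemma weightedSumLaw_gaussianReal (σ : ℝ≥0) {a : ι → ℝ} (ha : ∑ j, a j ^ 2 = 1) :
    weightedSumLaw (gaussianReal 0 σ) a = gaussianReal 0 σ := by
  refine Measure.ext_of_charFun (funext fun t => ?_)
  have hexp : ∑ j, -((σ : ℂ) * (a j * t : ℝ) ^ 2 / 2) = -((σ : ℂ) * t ^ 2 / 2) := by
    rw [← one_mul (-((σ : ℂ) * t ^ 2 / 2)), ← Complex.ofReal_one, ← ha, Complex.ofReal_sum,
      Finset.sum_mul]
    refine Finset.sum_congr rfl fun j _ => ?_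
    push_cast
    ring
  simp only [charFun_weightedSumLaw, charFun_gaussianReal, ← Complex.exp_sum, Complex.ofReal_zero,
    mul_zero, zero_mul, zero_sub, hexp]

end WeightedSumLaw

lemma isNoiseLaw_gaussianReal (σ : ℝ≥0) : IsNoiseLaw (gaussianReal 0 σ) σ where
  isProbabilityMeasure := inferInstance
  memLp := memLp_id_gaussianReal 2
  mean_eq_zero := integral_id_gaussianReal
  second_moment_eq := by
    have h := variance_id_gaussianReal (μ := 0) (v := σ)
    rw [variance_eq_integral (by fun_prop)] at h
    simpa [integral_id_gaussianReal] using h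

namespace IsNoiseLaw

variable {ν : Measure ℝ} {σ : ℝ≥0}

lemma charFun_sub_isLittleO (h : IsNoiseLaw ν σ) :
    (fun t : ℝ => charFun ν t - (1 - (σ : ℂ) * t ^ 2 / 2)) =o[𝓝 0] fun t => t ^ 2 := by
  have := h.isProbabilityMeasure
  have htaylor : ∀ t : ℝ,
      1 - (σ : ℂ) * t ^ 2 / 2 = taylorWithinEval (charFun ν) 2 Set.univ 0 t := by
    intro t
    have ht := taylorWithinEval_charFun_two_zero (P := ν) (X := id) (by fun_prop)
      (by rw [Measure.map_id]; exact h.memLp) t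
    simp only [Measure.map_id, id_eq, Pi.pow_apply, h.mean_eq_zero, h.second_moment_eq] at ht
    simp only [ht, Complex.ofReal_zero, zero_mul, add_zero]
  simp_rw [htaylor]
  convert! taylor_isLittleO_univ ?_
  · simp
  · exact contDiff_charFun h.memLp

lemma charFun_sub_charFun_gaussianReal_isLittleO (h : IsNoiseLaw ν σ) :
    (fun t => charFun ν t - charFun (gaussianReal 0 σ) t) =o[𝓝 0] fun t => t ^ 2 := by
  simpa using h.charFun_sub_isLittleO.sub (isNoiseLaw_gaussianReal σ).charFun_sub_isLittleO

lemma eq_gaussianReal (h : IsNoiseLaw ν 0) : ν = gaussianReal 0 0 := by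
  have := h.isProbabilityMeasure
  have hsq : ∫ x, x ^ 2 ∂ν = 0 := by simpa using h.second_moment_eq
  rw [integral_eq_zero_iff_of_nonneg (fun x => sq_nonneg x) h.memLp.integrable_sq] at hsq
  have hid : (id : ℝ → ℝ) =ᵐ[ν] fun _ => 0 := by
    filter_upwards [hsq] with x hx
    simpa using hx
  rw [← Measure.map_id (μ := ν), Measure.map_congr hid, Measure.map_const]
  simp

end IsNoiseLaw

lemma norm_charFun_weightedSumLaw_sub_le {ι : Type*} [Fintype ι] {ν γ : Measure ℝ}
    [IsProbabilityMeasure ν] [IsProbabilityMeasure γ] {c r : ℝ}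
    (h : ∀ s, |s| < r → ‖charFun ν s - charFun γ s‖ ≤ c * s ^ 2) {a : ι → ℝ} {t : ℝ}
    (ha : ∀ j, |a j * t| < r) :
    ‖charFun (weightedSumLaw ν a) t - charFun (weightedSumLaw γ a) t‖ ≤
      c * ((∑ j, a j ^ 2) * t ^ 2) := by
  rw [charFun_weightedSumLaw, charFun_weightedSumLaw]
  calc ‖∏ j, charFun ν (a j * t) - ∏ j, charFun γ (a j * t)‖
      ≤ ∑ j, ‖charFun ν (a j * t) - charFun γ (a j * t)‖ :=
        norm_prod_sub_prod_le _ (fun _ _ => norm_charFun_le_one _) fun _ _ => norm_charFun_le_one _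
    _ ≤ ∑ j, c * (a j * t) ^ 2 := Finset.sum_le_sum fun j _ => h _ (ha j)
    _ = c * ((∑ j, a j ^ 2) * t ^ 2) := by simp only [mul_pow, Finset.sum_mul, Finset.mul_sum]

section CentralLimit

variable {ν : Measure ℝ} {σ : ℝ≥0} {ι : ℕ → Type*} [∀ i, Fintype (ι i)] {a : (i : ℕ) → ι i → ℝ}
  {r : ℕ → ℝ}

lemma tendsto_charFun_weightedSumLaw (h : IsNoiseLaw ν σ) (ha : ∀ i, ∑ j, a i j ^ 2 = 1)
    (har : ∀ i j, |a i j| ≤ r i) (hr : Tendsto r atTop (𝓝 0)) (t : ℝ) :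
    Tendsto (fun i => charFun (weightedSumLaw ν (a i)) t) atTop
      (𝓝 (charFun (gaussianReal 0 σ) t)) := by
  have := h.isProbabilityMeasure
  rw [Metric.tendsto_nhds]
  intro ε hε
  obtain ⟨r₀, hr₀, hlittle⟩ := Metric.eventually_nhds_iff.1
    (h.charFun_sub_charFun_gaussianReal_isLittleO.def (c := ε / (t ^ 2 + 1)) (by positivity))
  have hsmall : Tendsto (fun i => r i * |t|) atTop (𝓝 0) := by simpa using hr.mul_const |t|
  filter_upwards [hsmall.eventually_lt_const hr₀] with i hi
  rw [dist_eq_norm, ← weightedSumLaw_gaussianReal σ (ha i)]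
  calc _ ≤ ε / (t ^ 2 + 1) * ((∑ j, a i j ^ 2) * t ^ 2) := by
        refine norm_charFun_weightedSumLaw_sub_le (r := r₀) (fun s hs => ?_) fun j => ?_
        · simpa using @hlittle s (by simpa using hs)
        · rw [abs_mul]
          exact (mul_le_mul_of_nonneg_right (har i j) (abs_nonneg t)).trans_lt hi
    _ = ε * (t ^ 2 / (t ^ 2 + 1)) := by rw [ha]; ring
    _ < ε * 1 := by
        gcongr
        rw [div_lt_one (by positivity)]
        linarith
    _ = ε := mul_one ε

lemma tendsto_weightedSumLaw_Ico (h : IsNoiseLaw ν σ) (ha : ∀ i, ∑ j, a i j ^ 2 = 1)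
    (har : ∀ i j, |a i j| ≤ r i) (hr : Tendsto r atTop (𝓝 0)) (x y : ℝ) :
    Tendsto (fun i => weightedSumLaw ν (a i) (Set.Ico x y)) atTop
      (𝓝 (gaussianReal 0 σ (Set.Ico x y))) := by
  have := h.isProbabilityMeasure
  rcases eq_or_ne σ 0 with rfl | hσ
  · simp only [h.eq_gaussianReal, weightedSumLaw_gaussianReal 0 (ha _), tendsto_const_nhds]
  · have hlim : Tendsto (β := ProbabilityMeasure ℝ)
        (fun i => ⟨weightedSumLaw ν (a i), inferInstance⟩) atTop
        (𝓝 ⟨gaussianReal 0 σ, inferInstance⟩) :=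
      ProbabilityMeasure.tendsto_of_tendsto_charFun (tendsto_charFun_weightedSumLaw h ha har hr)
    refine ProbabilityMeasure.tendsto_measure_of_null_frontier_of_tendsto' hlim ?_
    have := nullSingletonClass_gaussianReal (μ := 0) hσ
    have hpair : gaussianReal 0 σ {x, y} = 0 := (Set.toFinite {x, y}).measure_zero _
    refine measure_mono_null ?_ hpair
    rcases lt_or_ge x y with hxy | hxy
    · rw [frontier_Ico hxy]
    · simp [Set.Ico_eq_empty hxy.not_gt]

end CentralLimit

/-- Convergence on singletons suffices for convergence on all sets because no mass can escape: the
limit is again a probability measure. -/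
lemma tendsto_measure_of_tendsto_singleton {T : Type*} [Countable T] [MeasurableSpace T]
    [MeasurableSingletonClass T] {μ : ℕ → Measure T} {μ₀ : Measure T}
    [∀ i, IsProbabilityMeasure (μ i)] [IsProbabilityMeasure μ₀]
    (h : ∀ x, Tendsto (fun i => μ i {x}) atTop (𝓝 (μ₀ {x}))) (S : Set T) :
    Tendsto (fun i => μ i S) atTop (𝓝 (μ₀ S)) := by
  have hliminf : ∀ U : Set T, μ₀ U ≤ atTop.liminf fun i => μ i U := by
    intro U
    have hsum : ∀ ν : Measure T, ν U = ∑' x : U, ν {(x : T)} := fun ν => by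
      rw [← Measure.tsum_indicator_apply_singleton ν U (Set.to_countable U).measurableSet,
        tsum_subtype U fun x => ν {x}]
    rw [hsum μ₀, ENNReal.tsum_eq_iSup_sum]
    refine iSup_le fun F => ?_
    rw [← (tendsto_finsetSum F fun x _ => h x).liminf_eq]
    refine liminf_le_liminf (Eventually.of_forall fun i => ?_)
    rw [hsum (μ i)]
    exact ENNReal.sum_le_tsum F
  exact tendsto_of_le_liminf_of_limsup_le (hliminf S)
    (limsup_measure_le_of_le_liminf_measure_compl (Set.to_countable S).measurableSet (hliminf Sᶜ))

instance {V : Type*} [Fintype V] (ν : V → Measure ℝ) [∀ v, IsProbabilityMeasure (ν v)] (n : ℕ) :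
    IsProbabilityMeasure (noiseLaw ν n) := by
  unfold noiseLaw
  infer_instance

namespace CodingScheme

variable {V : Type*} {L : ℕ} {N : UnicastNetwork V L} {P : ℝ} {n : ℕ} {R : Fin L → ℝ}

open scoped Classical in
theorem received_unique [Fintype V] (C : CodingScheme N P n R)
    {w : (i : Fin L) → MessageSet n (R i)} {z : V × Fin n → ℝ} {Y : V → Fin n → ℝ}
    (hY : ∀ v t, Y v t = (∑ u : V with N.graph.Adj u v,
      N.gain u v * C.transmit w u t (pastOf (Y u) t)) + z (v, t)) (v : V) :
    Y v = C.received w z v := by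
  suffices h : ∀ (t : ℕ) (ht : t < n) (v : V), Y v ⟨t, ht⟩ = C.received w z v ⟨t, ht⟩ from
    funext fun t => h t t.isLt v
  intro t
  induction t using Nat.strong_induction_on with
  | _ t ih =>
    intro ht v
    have hpast : ∀ u, pastOf (Y u) ⟨t, ht⟩ = pastOf (C.received w z u) ⟨t, ht⟩ := fun u =>
      funext fun s => ih s s.isLt (s.isLt.trans ht) u
    simp only [hY, received_eq, hpast]

lemma measurable_transmit (C : CodingScheme N P n R) (w : (i : Fin L) → MessageSet n (R i))
    (u : V) (t : Fin n) : Measurable (C.transmit w u t) := by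
  unfold transmit
  split_ifs
  · exact measurable_const
  · exact C.relay_measurable _ t

lemma measurable_received [Fintype V] (C : CodingScheme N P n R)
    (w : (i : Fin L) → MessageSet n (R i)) (v : V) : Measurable fun z => C.received w z v := by
  suffices h : ∀ (t : ℕ) (ht : t < n) (v : V), Measurable fun z => C.received w z v ⟨t, ht⟩ from
    measurable_pi_lambda _ fun t => h t t.isLt v
  intro t
  induction t using Nat.strong_induction_on with
  | _ t ih =>
    intro ht v
    simp only [received_eq]
    refine (Finset.measurable_sum _ fun u _ => ?_).add (measurable_pi_apply _)
    exact ((C.measurable_transmit w u _).comp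
      (measurable_pi_lambda _ fun s => ih s s.isLt (s.isLt.trans ht) u)).const_mul _

lemma measurableSet_errorSet [Fintype V] (C : CodingScheme N P n R)
    (w : (i : Fin L) → MessageSet n (R i)) : MeasurableSet (C.errorSet w) := by
  have h : C.errorSet w = ⋃ i, (fun z => C.dec i (C.received w z (N.dst i))) ⁻¹' {w i}ᶜ := by
    ext z
    simp only [errorSet, Set.mem_ofPred_eq, Set.mem_iUnion, Set.mem_preimage, Set.mem_compl_iff,
      Set.mem_singleton_iff, ne_eq, eq_comm]
  rw [h]
  exact MeasurableSet.iUnion fun i => (C.dec_measurable i).comp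
    (C.measurable_received w (N.dst i)) (measurableSet_singleton _).compl

/-- What the nodes can see of the received signals at reading precision `ρ`: the integers
`⌊2 ^ ρ * y⌋`. -/
noncomputable def readings [Fintype V] (C : CodingScheme N P n R)
    (w : (i : Fin L) → MessageSet n (R i)) (ρ : ℕ) (z : V × Fin n → ℝ) : V × Fin n → ℤ :=
  fun p => ⌊(2 : ℝ) ^ ρ * C.received w z p.1 p.2⌋

open scoped Classical in
/-- The noiseless part of the signal received at the (node, time) pair `p`, when the readings at
precision `ρ` are `x`. -/
noncomputable def signalOf [Fintype V] (C : CodingScheme N P n R)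
    (w : (i : Fin L) → MessageSet n (R i)) (ρ : ℕ) (x : V × Fin n → ℤ) (p : V × Fin n) : ℝ :=
  ∑ u : V with N.graph.Adj u p.1, N.gain u p.1 * C.transmit w u p.2
    (pastOf (fun t => ((2 : ℝ) ^ ρ)⁻¹ * (x (u, t) : ℝ)) p.2)

namespace HasReadingPrecision

variable {C : CodingScheme N P n R} {ρ : ℕ}

lemma transmit_truncate (hC : C.HasReadingPrecision ρ) (w : (i : Fin L) → MessageSet n (R i))
    (u : V) (t : Fin n) (y : Fin (t : ℕ) → ℝ) :
    C.transmit w u t (fun s => truncate ρ (y s)) = C.transmit w u t y := by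
  unfold transmit
  split_ifs
  · rfl
  · exact (hC.1 _ t y).symm

variable [Fintype V]

lemma received_eq_signalOf_add (hC : C.HasReadingPrecision ρ)
    (w : (i : Fin L) → MessageSet n (R i)) (z : V × Fin n → ℝ) (v : V) (t : Fin n) :
    C.received w z v t = C.signalOf w ρ (C.readings w ρ z) (v, t) + z (v, t) := by
  rw [received_eq, signalOf]
  congr! 3 with u
  exact (hC.transmit_truncate w u t _).symm

lemma readings_eq_iff (hC : C.HasReadingPrecision ρ) {w : (i : Fin L) → MessageSet n (R i)}
    {x : V × Fin n → ℤ} {z : V × Fin n → ℝ} :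
    C.readings w ρ z = x ↔ ∀ p, ⌊(2 : ℝ) ^ ρ * (C.signalOf w ρ x p + z p)⌋ = x p := by
  constructor
  · rintro rfl ⟨v, t⟩
    rw [← hC.received_eq_signalOf_add]
    rfl
  · intro hx
    have hreceived := C.received_unique (w := w) (z := z)
      (Y := fun v t => C.signalOf w ρ x (v, t) + z (v, t)) fun v t => by
        rw [signalOf]
        congr! 3 with u
        refine .trans ?_ (hC.transmit_truncate w u t _)
        simp only [pastOf, truncate, hx]
        rfl
    funext p
    rw [← hx p, readings, ← hreceived]

lemma readings_preimage_singleton (hC : C.HasReadingPrecision ρ)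
    (w : (i : Fin L) → MessageSet n (R i)) (x : V × Fin n → ℤ) :
    C.readings w ρ ⁻¹' {x} = Set.univ.pi fun p =>
      Set.Ico (((2 : ℝ) ^ ρ)⁻¹ * x p - C.signalOf w ρ x p)
        (((2 : ℝ) ^ ρ)⁻¹ * (x p + 1) - C.signalOf w ρ x p) := by
  have h2 : (0 : ℝ) < 2 ^ ρ := by positivity
  ext z
  simp only [Set.mem_preimage, Set.mem_singleton_iff, hC.readings_eq_iff, Int.floor_eq_iff,
    Set.mem_univ_pi, Set.mem_Ico, sub_le_iff_le_add', lt_sub_iff_add_lt', inv_mul_le_iff₀ h2,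
    lt_inv_mul_iff₀ h2]

lemma measurable_readings (hC : C.HasReadingPrecision ρ) (w : (i : Fin L) → MessageSet n (R i)) :
    Measurable (C.readings w ρ) := by
  refine measurable_to_countable' fun x => ?_
  rw [hC.readings_preimage_singleton]
  exact MeasurableSet.univ_pi fun _ => measurableSet_Ico

lemma exists_errorSet_eq_preimage (hC : C.HasReadingPrecision ρ)
    (w : (i : Fin L) → MessageSet n (R i)) :
    ∃ S : Set (V × Fin n → ℤ), C.errorSet w = C.readings w ρ ⁻¹' S := by
  refine ⟨{x | ∃ i, w i ≠ C.dec i fun t => ((2 : ℝ) ^ ρ)⁻¹ * (x (N.dst i, t) : ℝ)}, ?_⟩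
  ext z
  refine exists_congr fun i => ?_
  rw [hC.2]
  rfl

lemma tendsto_errorProb (hC : C.HasReadingPrecision ρ) {κ : ℕ → V → Measure ℝ}
    {γ : V → Measure ℝ} [∀ i v, IsProbabilityMeasure (κ i v)] [∀ v, IsProbabilityMeasure (γ v)]
    (h : ∀ v x y, Tendsto (fun i => κ i v (Set.Ico x y)) atTop (𝓝 (γ v (Set.Ico x y)))) :
    Tendsto (fun i => C.errorProb (κ i)) atTop (𝓝 (C.errorProb γ)) := by
  refine Tendsto.div_const (tendsto_finsetSum _ fun w _ => ?_) _
  have hmeas := hC.measurable_readings w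
  obtain ⟨S, hS⟩ := hC.exists_errorSet_eq_preimage w
  have := fun i => Measure.isProbabilityMeasure_map (μ := noiseLaw (κ i) n) hmeas.aemeasurable
  have := Measure.isProbabilityMeasure_map (μ := noiseLaw γ n) hmeas.aemeasurable
  have hlim := tendsto_measure_of_tendsto_singleton
    (μ := fun i => (noiseLaw (κ i) n).map (C.readings w ρ))
    (μ₀ := (noiseLaw γ n).map (C.readings w ρ)) (fun x => by
      simp only [Measure.map_apply hmeas (measurableSet_singleton x),
        hC.readings_preimage_singleton, noiseLaw, Measure.pi_pi]
      exact ENNReal.tendsto_finsetProd_of_ne_top _ (fun p _ => h _ _ _)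
        fun p _ => measure_ne_top _ _) S
  simp only [Measure.map_apply hmeas (Set.to_countable S).measurableSet, ← hS] at hlim
  exact (ENNReal.tendsto_toReal (measure_ne_top _ _)).comp hlim

theorem exists_forall_errorProb_weightedSumLaw_lt (hC : C.HasReadingPrecision ρ) {σsq : V → ℝ≥0}
    {δ : ℝ} (hδ : C.errorProb (awgn σsq) < δ) {ν : V → Measure ℝ}
    (hν : ∀ v, IsNoiseLaw (ν v) (σsq v)) :
    ∃ r > 0, ∀ (b : ℕ) (a : Fin b → ℝ), ∑ j, a j ^ 2 = 1 → (∀ j, |a j| ≤ r) →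
      C.errorProb (fun v => weightedSumLaw (ν v) a) < δ := by
  by_contra! hcon
  choose b a ha har hbad using fun i : ℕ => hcon (1 / ((i : ℝ) + 1)) Nat.one_div_pos_of_nat
  have := fun v => (hν v).isProbabilityMeasure
  have : ∀ v, IsProbabilityMeasure (awgn σsq v) := fun v => by unfold awgn; infer_instance
  have hlim := hC.tendsto_errorProb (κ := fun i v => weightedSumLaw (ν v) (a i))
    (γ := awgn σsq) fun v x y =>
      tendsto_weightedSumLaw_Ico (hν v) ha har tendsto_one_div_add_atTop_nhds_zero_nat x y
  exact hδ.not_ge (ge_of_tendsto' hlim hbad)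

end HasReadingPrecision

lemma errorProb_eq_expect [Fintype V] (C : CodingScheme N P n R) (ν : V → Measure ℝ) :
    C.errorProb ν = 𝔼 w, (noiseLaw ν n).real (C.errorSet w) :=
  (Fintype.expect_eq_sum_div_card _).symm

end CodingScheme

lemma sum_sq_transpose_mulVec {β : Type*} [Fintype β] [DecidableEq β] {Q : Matrix β β ℝ}
    (hQ : Q * Qᵀ = 1) (a : β → ℝ) : ∑ j, (Qᵀ *ᵥ a) j ^ 2 = ∑ l, a l ^ 2 := by
  have h : (Qᵀ *ᵥ a) ⬝ᵥ (Qᵀ *ᵥ a) = a ⬝ᵥ a := by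
    rw [Matrix.dotProduct_mulVec, Matrix.vecMul_transpose, Matrix.mulVec_mulVec, hQ,
      Matrix.one_mulVec]
  simpa only [dotProduct, sq] using h

/-- A placement of copies of a block of length `n`, indexed by `κ × β`, into a block of length `m`:
in group `g : κ`, the `β` many coordinates of the inner time `t` are sent at the distinct times
`slot (g, t, j)`, `j : β`, all of which come after those of earlier inner times. -/
structure Schedule (κ β : Type*) (n m : ℕ) where
  /-- The time at which group `p.1` sends coordinate `p.2.2` of its inner time `p.2.1`. -/
  slot : κ × Fin n × β ↪ Fin m
  slot_lt_slot : ∀ (g : κ) {s t : Fin n}, s < t → ∀ j j' : β, slot (g, s, j) < slot (g, t, j')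

namespace Schedule

/-- The schedule that runs the groups, their inner times and their coordinates in lexicographic
order. -/
def lexicographic {k n b m : ℕ} (h : k * (n * b) ≤ m) : Schedule (Fin k) (Fin b) n m where
  slot := ((Equiv.prodCongrRight fun _ => finProdFinEquiv).trans finProdFinEquiv).toEmbedding.trans
    (Fin.castLEEmb h)
  slot_lt_slot g s t hst j j' := by
    have hmul : b * ((s : ℕ) + 1) ≤ b * t := Nat.mul_le_mul_left b hst
    have hj := j.isLt
    change (j : ℕ) + b * s + n * b * g < j' + b * t + n * b * g
    rw [mul_add, mul_one] at hmul
    omega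

variable {κ β : Type*} [Fintype β] {n m : ℕ} (S : Schedule κ β n m)
  (Q : Matrix β β ℝ)

/-- The block that sends the inner blocks `a q`, the `β` many blocks of each group being combined
at each inner time by the transpose of `Q`; nothing is sent at the unscheduled times. -/
noncomputable def spread (a : κ × β → Fin n → ℝ) : Fin m → ℝ :=
  Function.extend S.slot (fun p => (Qᵀ *ᵥ fun l => a (p.1, l) p.2.1) p.2.2) 0

/-- The inner blocks recovered from a block by undoing `Schedule.spread` for orthogonal `Q`. -/
def despread : (Fin m → ℝ) →ₗ[ℝ] κ × β → Fin n → ℝ where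
  toFun y q t := (Q *ᵥ fun j => y (S.slot (q.1, t, j))) q.2
  map_add' y y' := by
    ext q t
    exact congrFun (Matrix.mulVec_add Q _ _) q.2
  map_smul' c y := by
    ext q t
    exact congrFun (Matrix.mulVec_smul Q c _) q.2

variable {S Q}

lemma spread_slot (a : κ × β → Fin n → ℝ) (g : κ) (t : Fin n) (j : β) :
    S.spread Q a (S.slot (g, t, j)) = (Qᵀ *ᵥ fun l => a (g, l) t) j :=
  S.slot.injective.extend_apply _ _ _

lemma spread_of_notMem_range {τ : Fin m} (hτ : τ ∉ Set.range S.slot) (a : κ × β → Fin n → ℝ) :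
    S.spread Q a τ = 0 :=
  Function.extend_apply' _ _ _ hτ

lemma measurable_spread : Measurable (S.spread Q) := by
  refine measurable_pi_lambda _ fun τ => ?_
  by_cases hτ : τ ∈ Set.range S.slot
  · obtain ⟨⟨g, t, j⟩, rfl⟩ := hτ
    simp only [spread_slot, Matrix.mulVec, dotProduct]
    fun_prop
  · simp only [spread_of_notMem_range hτ, measurable_const]

lemma measurable_despread : Measurable (S.despread Q) :=
  measurable_pi_lambda _ fun q => measurable_pi_lambda _ fun t => by
    simp only [despread, LinearMap.coe_mk, AddHom.coe_mk, Matrix.mulVec, dotProduct]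
    fun_prop

lemma pastOf_despread_congr {y y' : Fin m → ℝ} {g : κ} {t : Fin n} {j : β}
    (h : ∀ τ < S.slot (g, t, j), y τ = y' τ) (l : β) :
    pastOf (S.despread Q y (g, l)) t = pastOf (S.despread Q y' (g, l)) t := by
  funext s
  refine congrArg (fun a => (Q *ᵥ a) l) (funext fun j' => h _ ?_)
  exact S.slot_lt_slot g (Fin.lt_def.2 s.isLt) j' j

variable [DecidableEq β]

lemma despread_spread (hQ : Q * Qᵀ = 1) (a : κ × β → Fin n → ℝ) :
    S.despread Q (S.spread Q a) = a := by
  ext ⟨g, l⟩ t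
  simp only [despread, LinearMap.coe_mk, AddHom.coe_mk, spread_slot, Matrix.mulVec_mulVec, hQ,
    Matrix.one_mulVec]

lemma sum_sq_spread [Fintype κ] (hQ : Q * Qᵀ = 1) (a : κ × β → Fin n → ℝ) :
    ∑ τ, S.spread Q a τ ^ 2 = ∑ q, ∑ t, a q t ^ 2 := by
  calc ∑ τ, S.spread Q a τ ^ 2
      = ∑ p : κ × Fin n × β, (Qᵀ *ᵥ fun l => a (p.1, l) p.2.1) p.2.2 ^ 2 :=
        (Fintype.sum_of_injective S.slot S.slot.injective _ _
          (fun τ hτ => by rw [spread_of_notMem_range hτ, zero_pow two_ne_zero])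
          fun p => by rw [← spread_slot]).symm
    _ = ∑ g, ∑ t, ∑ l, a (g, l) t ^ 2 := by
        simp only [Fintype.sum_prod_type, sum_sq_transpose_mulVec hQ]
    _ = ∑ q, ∑ t, a q t ^ 2 := by
        simp only [Fintype.sum_prod_type]
        exact Finset.sum_congr rfl fun g _ => Finset.sum_comm

omit [DecidableEq β] in
include S in
lemma card_mul_le [Fintype κ] : Fintype.card κ * (n * Fintype.card β) ≤ m := by
  simpa using Fintype.card_le_of_embedding S.slot

lemma power_spread_le [Finite κ] (hQ : Q * Qᵀ = 1) {P : ℝ} (hP : 0 ≤ P) {a : κ × β → Fin n → ℝ}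
    (ha : ∀ q, (1 / (n : ℝ)) * ∑ t, a q t ^ 2 ≤ P) :
    (1 / (m : ℝ)) * ∑ τ, S.spread Q a τ ^ 2 ≤ P := by
  have := Fintype.ofFinite κ
  have hsum : ∀ q, ∑ t, a q t ^ 2 ≤ n * P := by
    intro q
    rcases n.eq_zero_or_pos with rfl | hn
    · simp
    · simpa only [one_div, inv_mul_le_iff₀ (Nat.cast_pos (α := ℝ).2 hn)] using ha q
  have hcard : ((Fintype.card κ * (n * Fintype.card β) : ℕ) : ℝ) ≤ m :=
    Nat.cast_le.2 S.card_mul_le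
  refine (mul_le_mul_of_nonneg_left (c := (m : ℝ) * P) ?_ (by positivity)).trans ?_
  · calc ∑ τ, S.spread Q a τ ^ 2 = ∑ q, ∑ t, a q t ^ 2 := sum_sq_spread hQ a
      _ ≤ ∑ _q : κ × β, n * P := Finset.sum_le_sum fun q _ => hsum q
      _ = ((Fintype.card κ * (n * Fintype.card β) : ℕ) : ℝ) * P := by simp; ring
      _ ≤ m * P := mul_le_mul_of_nonneg_right hcard hP
  · rw [← mul_assoc, one_div]
    exact mul_le_of_le_one_left hP (inv_mul_le_one (a := (m : ℝ)))

end Schedule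

/-- The continuation of the past of a block by zeros, used to feed a function of whole blocks with
only what a relay knows. -/
def zeroExtend {t : ℕ} (m : ℕ) (y : Fin t → ℝ) : Fin m → ℝ :=
  fun τ => if hτ : (τ : ℕ) < t then y ⟨τ, hτ⟩ else 0

lemma zeroExtend_pastOf {m : ℕ} (y : Fin m → ℝ) {t τ : Fin m} (hτ : τ < t) :
    zeroExtend m (pastOf y t) τ = y τ :=
  dif_pos (Fin.lt_def.1 hτ)

lemma measurable_zeroExtend (t m : ℕ) : Measurable (zeroExtend (t := t) m) := by
  refine measurable_pi_lambda _ fun τ => ?_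
  unfold zeroExtend
  split_ifs <;> fun_prop

lemma measurable_pastOf {n : ℕ} (t : Fin n) : Measurable fun y => pastOf y t :=
  measurable_pi_lambda _ fun _ => measurable_pi_apply _

namespace CodingScheme

variable {V : Type*} {L : ℕ} {N : UnicastNetwork V L} {P : ℝ} {n : ℕ} {R : Fin L → ℝ}

lemma power_nonneg (C : CodingScheme N P n R) (v : N.NonSource) : 0 ≤ P :=
  le_trans (by positivity) (C.relay_power v 0)

variable {κ β : Type*} [Fintype β] {m : ℕ} {Q : Matrix β β ℝ} {R' : Fin L → ℝ}

/-- The block that a relay would send if it ran the inner schemes on the whole block `y`. -/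
noncomputable def relayBlock (C : CodingScheme N P n R) (S : Schedule κ β n m)
    (Q : Matrix β β ℝ) (v : N.NonSource) (y : Fin m → ℝ) : Fin m → ℝ :=
  S.spread Q fun q t => C.relay v t (pastOf (S.despread Q y q) t)

lemma relayBlock_zeroExtend (C : CodingScheme N P n R) (S : Schedule κ β n m)
    (v : N.NonSource) (y : Fin m → ℝ) (τ : Fin m) :
    C.relayBlock S Q v (zeroExtend m (pastOf y τ)) τ = C.relayBlock S Q v y τ := by
  by_cases hτ : τ ∈ Set.range S.slot
  · obtain ⟨⟨g, t, j⟩, rfl⟩ := hτ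
    simp only [relayBlock, Schedule.spread_slot,
      Schedule.pastOf_despread_congr fun _ hτ => zeroExtend_pastOf y hτ]
  · simp only [relayBlock, Schedule.spread_of_notMem_range hτ]

variable [Fintype κ] [DecidableEq β]

/-- The scheme of block length `m` that runs the copies of `C` indexed by `κ × β` on the schedule
`S`, with outer encoders `enc'` and outer decoders `dec'`. -/
noncomputable def interleave (C : CodingScheme N P n R) (S : Schedule κ β n m)
    (hQ : Q * Qᵀ = 1)
    (enc' : (i : Fin L) → MessageSet m (R' i) → κ × β → MessageSet n (R i))
    (dec' : (i : Fin L) → (κ × β → MessageSet n (R i)) → MessageSet m (R' i)) :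
    CodingScheme N P m R' where
  enc i x := S.spread Q fun q => C.enc i (enc' i x q)
  relay v τ past := C.relayBlock S Q v (zeroExtend m past) τ
  dec i y := dec' i fun q => C.dec i (S.despread Q y q)
  enc_power i x :=
    Schedule.power_spread_le hQ
      (C.power_nonneg ⟨N.dst i, fun ⟨j, hj⟩ => N.src_ne_dst j i hj⟩) fun q => C.enc_power i _
  relay_power v y := by
    simp only [relayBlock_zeroExtend]
    exact Schedule.power_spread_le hQ (C.power_nonneg v) fun q => C.relay_power v _
  relay_measurable v τ := by
    refine (measurable_pi_apply τ).comp (Schedule.measurable_spread.comp ?_)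
    refine measurable_pi_lambda _ fun q => measurable_pi_lambda _ fun t => ?_
    exact ((C.relay_measurable v t).comp (measurable_pastOf t)).comp
      ((measurable_pi_apply q).comp (Schedule.measurable_despread.comp (measurable_zeroExtend _ m)))
  dec_measurable i := by
    refine (measurable_of_countable (dec' i)).comp (measurable_pi_lambda _ fun q => ?_)
    exact (C.dec_measurable i).comp ((measurable_pi_apply q).comp Schedule.measurable_despread)

end CodingScheme

/-- The noise seen by the inner scheme `q` when the noise over the whole block is `z`. -/
def Schedule.innerNoise {V κ β : Type*} [Fintype β] {n m : ℕ} (S : Schedule κ β n m)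
    (Q : Matrix β β ℝ) (z : V × Fin m → ℝ) (q : κ × β) : V × Fin n → ℝ :=
  fun p => S.despread Q (fun τ => z (p.1, τ)) q p.2

namespace CodingScheme

variable {V : Type*} [Fintype V] {L : ℕ} {N : UnicastNetwork V L} {P : ℝ} {n : ℕ} {R : Fin L → ℝ}
  {κ β : Type*} [Fintype κ] [Fintype β] [DecidableEq β] {m : ℕ} {Q : Matrix β β ℝ}
  {R' : Fin L → ℝ}

omit [Fintype V] in
lemma transmit_interleave (C : CodingScheme N P n R) (S : Schedule κ β n m) (hQ : Q * Qᵀ = 1)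
    (enc' : (i : Fin L) → MessageSet m (R' i) → κ × β → MessageSet n (R i))
    (dec' : (i : Fin L) → (κ × β → MessageSet n (R i)) → MessageSet m (R' i))
    (x : (i : Fin L) → MessageSet m (R' i)) (u : V) (τ : Fin m) (y : Fin m → ℝ) :
    (C.interleave S hQ enc' dec').transmit x u τ (pastOf y τ) =
      S.spread Q (fun q t => C.transmit (fun i => enc' i (x i) q) u t
        (pastOf (S.despread Q y q) t)) τ := by
  unfold transmit
  split_ifs with hu
  · rfl
  · exact C.relayBlock_zeroExtend S ⟨u, hu⟩ y τ

lemma despread_received_interleave (C : CodingScheme N P n R) (S : Schedule κ β n m)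
    (hQ : Q * Qᵀ = 1)
    (enc' : (i : Fin L) → MessageSet m (R' i) → κ × β → MessageSet n (R i))
    (dec' : (i : Fin L) → (κ × β → MessageSet n (R i)) → MessageSet m (R' i))
    (x : (i : Fin L) → MessageSet m (R' i)) (z : V × Fin m → ℝ) (q : κ × β) (v : V) :
    S.despread Q ((C.interleave S hQ enc' dec').received x z v) q =
      C.received (fun i => enc' i (x i) q) (S.innerNoise Q z q) v := by
  classical
  set Y := (C.interleave S hQ enc' dec').received x z
  refine C.received_unique (Y := fun v => S.despread Q (Y v) q) (fun v t => ?_) v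
  have hY : Y v = (∑ u : V with N.graph.Adj u v, N.gain u v • S.spread Q fun q t =>
      C.transmit (fun i => enc' i (x i) q) u t (pastOf (S.despread Q (Y u) q) t)) +
        fun τ => z (v, τ) := by
    funext τ
    refine (received_eq _ x z v τ).trans ?_
    simp only [transmit_interleave, Pi.add_apply, Finset.sum_apply, Pi.smul_apply, smul_eq_mul]
    congr!
  rw [hY]
  simp only [map_add, map_sum, map_smul, Schedule.despread_spread hQ, Pi.add_apply,
    Finset.sum_apply, Pi.smul_apply, smul_eq_mul]
  rfl

lemma mem_errorSet_interleave (C : CodingScheme N P n R) (S : Schedule κ β n m)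
    (hQ : Q * Qᵀ = 1)
    (enc' : (i : Fin L) → MessageSet m (R' i) → κ × β → MessageSet n (R i))
    (dec' : (i : Fin L) → (κ × β → MessageSet n (R i)) → MessageSet m (R' i))
    (x : (i : Fin L) → MessageSet m (R' i)) (z : V × Fin m → ℝ) :
    z ∈ (C.interleave S hQ enc' dec').errorSet x ↔ ∃ i, x i ≠ dec' i fun q =>
      C.dec i (C.received (fun i => enc' i (x i) q) (S.innerNoise Q z q) (N.dst i)) := by
  simp only [← C.despread_received_interleave S hQ enc' dec']
  rfl

end CodingScheme

lemma map_pi_curry_of_injective {ι A β Ω : Type*} [Fintype ι] [Fintype A] [Fintype β]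
    [MeasurableSpace Ω] (μ : ι → Measure Ω) [∀ i, IsProbabilityMeasure (μ i)] {e : A × β → ι}
    (he : Function.Injective e) :
    (Measure.pi μ).map (fun z a j => z (e (a, j))) =
      Measure.pi fun a => Measure.pi fun j => μ (e (a, j)) := by
  have hcomp := Measure.map_infinitePi_infinitePi_of_inj (P := μ) he
  have hcurry := Measure.infinitePi_map_curry fun a j => μ (e (a, j))
  simp only [Measure.infinitePi_eq_pi] at hcomp hcurry
  rw [← hcurry]
  change _ = (Measure.pi fun p => μ (e p)).map _
  rw [← hcomp, Measure.map_map (by fun_prop) (by fun_prop)]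
  rfl

lemma map_weightedSums_pi {ι A β : Type*} [Fintype ι] [Fintype A] [Fintype β] (μ : ι → Measure ℝ)
    [∀ i, IsProbabilityMeasure (μ i)] {e : A × β → ι} (he : Function.Injective e)
    {γ : A → Measure ℝ} (hγ : ∀ a j, μ (e (a, j)) = γ a) (w : A → β → ℝ) :
    (Measure.pi μ).map (fun z a => ∑ j, w a j * z (e (a, j))) =
      Measure.pi fun a => weightedSumLaw (γ a) (w a) := by
  have hsum : ∀ a, Measurable fun z : β → ℝ => ∑ j, w a j * z j := fun a => by fun_prop
  have hmap := Measure.pi_map_pi (μ := fun a => Measure.pi fun j => μ (e (a, j)))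
    fun a => (hsum a).aemeasurable
  rw [← map_pi_curry_of_injective μ he, Measure.map_map (by fun_prop) (by fun_prop)] at hmap
  simp only [hγ] at hmap
  exact hmap

namespace Schedule

variable {V κ β : Type*} [Fintype β] {n m : ℕ} (S : Schedule κ β n m) (Q : Matrix β β ℝ)

lemma measurable_innerNoise (q : κ × β) :
    Measurable fun z : V × Fin m → ℝ => S.innerNoise Q z q := by
  refine measurable_pi_lambda _ fun p => ?_
  exact (measurable_pi_apply p.2).comp ((measurable_pi_apply q).comp
    (measurable_despread.comp (measurable_pi_lambda _ fun τ => measurable_pi_apply _)))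

variable [Fintype V] (ν : V → Measure ℝ) [∀ v, IsProbabilityMeasure (ν v)]

lemma map_innerNoise (q : κ × β) :
    (noiseLaw ν m).map (fun z => S.innerNoise Q z q) =
      noiseLaw (fun v => weightedSumLaw (ν v) (Q q.2)) n := by
  refine map_weightedSums_pi (fun p : V × Fin m => ν p.1)
    (e := fun a : (V × Fin n) × β => (a.1.1, S.slot (q.1, a.1.2, a.2))) ?_ (γ := fun p => ν p.1)
    (fun _ _ => rfl) fun _ => Q q.2
  rintro ⟨⟨v, t⟩, j⟩ ⟨⟨v', t'⟩, j'⟩ h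
  simpa [and_assoc] using h

lemma indepFun_innerNoise {q q' : κ × β} (hq : q.1 ≠ q'.1) :
    IndepFun (fun z => S.innerNoise Q z q) (fun z => S.innerNoise Q z q') (noiseLaw ν m) := by
  classical
  let T : κ → Finset (V × Fin m) := fun g =>
    Finset.univ.image fun a : (V × Fin n) × β => (a.1.1, S.slot (g, a.1.2, a.2))
  have hmem : ∀ g (p : V × Fin n) j, (p.1, S.slot (g, p.2, j)) ∈ T g := fun g p j =>
    Finset.mem_image_of_mem _ (Finset.mem_univ (p, j))
  have hdisj : Disjoint (T q.1) (T q'.1) := by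
    refine Finset.disjoint_left.2 fun _ h h' => ?_
    obtain ⟨⟨p, j⟩, -, rfl⟩ := Finset.mem_image.1 h
    obtain ⟨⟨p', j'⟩, -, heq⟩ := Finset.mem_image.1 h'
    exact hq (congrArg Prod.fst (S.slot.injective (congrArg Prod.snd heq))).symm
  have hcoord : iIndepFun (fun (p : V × Fin m) (z : V × Fin m → ℝ) => z p) (noiseLaw ν m) :=
    iIndepFun_pi (X := fun _ x => x) fun _ => aemeasurable_id
  have hφ : ∀ q : κ × β, Measurable fun (y : T q.1 → ℝ) (p : V × Fin n) =>
      ∑ j, Q q.2 j * y ⟨_, hmem q.1 p j⟩ := fun q => by fun_prop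
  exact (hcoord.indepFun_finset _ _ hdisj fun p => measurable_pi_apply p).comp (hφ q) (hφ q')

end Schedule

lemma covariance_indicator_one {Ω : Type*} [MeasurableSpace Ω] {μ : Measure Ω}
    [IsProbabilityMeasure μ] {s t : Set Ω} (hs : MeasurableSet s) (ht : MeasurableSet t) :
    cov[s.indicator 1, t.indicator 1; μ] = μ.real (s ∩ t) - μ.real s * μ.real t := by
  have hmem : ∀ u : Set Ω, MeasurableSet u → MemLp (u.indicator (1 : Ω → ℝ)) 2 μ :=
    fun u hu => (memLp_const 1).indicator hu
  rw [covariance_eq_sub (hmem s hs) (hmem t ht), ← Set.inter_indicator_one,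
    integral_indicator_one hs, integral_indicator_one ht, integral_indicator_one (hs.inter ht)]

lemma indepSet_iff_measureReal_inter_eq_mul {Ω : Type*} [MeasurableSpace Ω] {μ : Measure Ω}
    [IsProbabilityMeasure μ] {s t : Set Ω} (hs : MeasurableSet s) (ht : MeasurableSet t) :
    IndepSet s t μ ↔ μ.real (s ∩ t) = μ.real s * μ.real t := by
  rw [indepSet_iff_measure_inter_eq_mul hs ht μ, measureReal_def, measureReal_def, measureReal_def,
    ← ENNReal.toReal_mul, ENNReal.toReal_eq_toReal_iff' (by finiteness) (by finiteness)]

section Chebyshev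

open scoped Classical in
lemma sum_indicator_one_eq_card {ι Ω : Type*} [Fintype ι] (A : ι → Set Ω) (ω : Ω) :
    ∑ p, (A p).indicator (1 : Ω → ℝ) ω = #{p | ω ∈ A p} := by
  simp [Set.indicator_apply]

variable {ι Ω : Type*} [Fintype ι] [MeasurableSpace Ω] {μ : Measure Ω} [IsProbabilityMeasure μ]
  {A : ι → Set Ω}

lemma variance_sum_indicator_one_le (hA : ∀ p, MeasurableSet (A p)) (r : ι → ι → Prop)
    [DecidableRel r] (hr : ∀ p q, ¬ r p q → IndepSet (A p) (A q) μ) :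
    Var[fun ω => ∑ p, (A p).indicator (1 : Ω → ℝ) ω; μ] ≤ #{p : ι × ι | r p.1 p.2} := by
  have hcov : ∀ p q, cov[(A p).indicator 1, (A q).indicator 1; μ] ≤
      if r p q then (1 : ℝ) else 0 := by
    intro p q
    rw [covariance_indicator_one (hA p) (hA q)]
    split_ifs with h
    · have h0 : 0 ≤ μ.real (A p) * μ.real (A q) := by positivity
      linarith [measureReal_le_one (μ := μ) (s := A p ∩ A q)]
    · rw [(indepSet_iff_measureReal_inter_eq_mul (hA p) (hA q)).1 (hr p q h), sub_self]
  calc _ = ∑ p, ∑ q, cov[(A p).indicator 1, (A q).indicator 1; μ] :=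
        variance_fun_sum fun p => (memLp_const 1).indicator (hA p)
    _ ≤ ∑ p, ∑ q, if r p q then (1 : ℝ) else 0 :=
        Finset.sum_le_sum fun p _ => Finset.sum_le_sum fun q _ => hcov p q
    _ = _ := by rw [← Finset.sum_boole, Fintype.sum_prod_type]

open scoped Classical in
lemma measureReal_mul_card_le_count_le (hA : ∀ p, MeasurableSet (A p)) (r : ι → ι → Prop)
    (hr : ∀ p q, ¬ r p q → IndepSet (A p) (A q) μ) {δ θ : ℝ} (hδ : ∀ p, μ.real (A p) ≤ δ)
    (hθ : δ < θ) [Nonempty ι] :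
    μ.real {ω | θ * Fintype.card ι ≤ #{p | ω ∈ A p}} ≤
      #{p : ι × ι | r p.1 p.2} / ((θ - δ) * Fintype.card ι) ^ 2 := by
  let X : Ω → ℝ := fun ω => ∑ p, (A p).indicator (1 : Ω → ℝ) ω
  have hXcount : ∀ ω, X ω = #{p | ω ∈ A p} := sum_indicator_one_eq_card A
  have hmem : ∀ p, MemLp ((A p).indicator (1 : Ω → ℝ)) 2 μ := fun p =>
    (memLp_const 1).indicator (hA p)
  have hmean : ∫ ω, X ω ∂μ ≤ δ * Fintype.card ι := by
    rw [integral_finsetSum _ fun p _ => (hmem p).integrable one_le_two]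
    calc _ = ∑ p, μ.real (A p) := by simp only [integral_indicator_one (hA _)]
      _ ≤ _ := (Finset.sum_le_card_nsmul _ _ δ fun p _ => hδ p).trans_eq (by simp [mul_comm])
  have hpos : 0 < (θ - δ) * Fintype.card ι :=
    mul_pos (sub_pos.2 hθ) (by exact_mod_cast Fintype.card_pos)
  calc _ ≤ μ.real {ω | (θ - δ) * Fintype.card ι ≤ |X ω - ∫ ω, X ω ∂μ|} := by
        simp only [← hXcount]
        refine measureReal_mono fun ω hω => ?_
        have : θ * Fintype.card ι ≤ X ω := hω
        refine le_trans ?_ (le_abs_self (X ω - ∫ ω, X ω ∂μ))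
        linarith
    _ ≤ Var[X; μ] / ((θ - δ) * Fintype.card ι) ^ 2 :=
        ENNReal.toReal_le_of_le_ofReal (by have := variance_nonneg X μ; positivity)
          (meas_ge_le_variance_div_sq (memLp_finsetSum _ fun p _ => hmem p) hpos)
    _ ≤ _ := by gcongr; exact variance_sum_indicator_one_le hA r hr

end Chebyshev

lemma ncard_fiber_mul_card {X Y : Type*} [AddGroup X] [AddGroup Y] [Finite X] [Finite Y]
    (φ : X →+ Y) (hφ : Function.Surjective φ) (y : Y) :
    {x | φ x = y}.ncard * Nat.card Y = Nat.card X := by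
  classical
  have := Fintype.ofFinite X
  have := Fintype.ofFinite Y
  rw [Set.ncard_eq_toFinset_card', Set.toFinset_ofPred, Nat.card_eq_fintype_card,
    Nat.card_eq_fintype_card]
  calc _ = ∑ y', #{x | φ x = y'} := by
        rw [Finset.sum_congr rfl fun y' _ =>
          AddMonoidHom.card_fiber_eq_of_mem_range φ (hφ y') (hφ y)]
        simp [mul_comm]
    _ = _ :=
        (Finset.card_eq_sum_card_fiberwise fun _ _ => Finset.mem_coe.2 (Finset.mem_univ _)).symm

lemma expect_comp_of_surjective {X Y : Type*} [AddGroup X] [AddGroup Y] [Fintype X] [Fintype Y]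
    (φ : X →+ Y) (hφ : Function.Surjective φ) (f : Y → ℝ) : 𝔼 x, f (φ x) = 𝔼 y, f y := by
  classical
  have hX : (Nat.card X : ℝ) ≠ 0 := Nat.cast_ne_zero.2 Nat.card_pos.ne'
  have hY : (Nat.card Y : ℝ) ≠ 0 := Nat.cast_ne_zero.2 Nat.card_pos.ne'
  rw [Fintype.expect_eq_sum_div_card, Fintype.expect_eq_sum_div_card, ← Nat.card_eq_fintype_card,
    ← Nat.card_eq_fintype_card, div_eq_div_iff hX hY, ← Finset.sum_fiberwise (g := φ),
    Finset.sum_mul, Finset.sum_mul]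
  refine Finset.sum_congr rfl fun y _ => ?_
  rw [Finset.sum_congr rfl fun x hx => congrArg f (Finset.mem_filter.1 hx).2, Finset.sum_const,
    nsmul_eq_mul, ← ncard_fiber_mul_card φ hφ y, Set.ncard_eq_toFinset_card', Set.toFinset_ofPred]
  push_cast
  ring

lemma measureReal_uniformOn_univ_prod {X Ω : Type*} [Fintype X] [Nonempty X] [MeasurableSpace X]
    [MeasurableSingletonClass X] [MeasurableSpace Ω] (μ : Measure Ω) [IsProbabilityMeasure μ]
    {s : Set (X × Ω)} (hs : MeasurableSet s) :
    ((uniformOn Set.univ).prod μ).real s = 𝔼 x, μ.real (Prod.mk x ⁻¹' s) := by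
  have := isProbabilityMeasure_uniformOn (Ω := X) Set.finite_univ Set.univ_nonempty
  have hatom : ∀ x : X, (uniformOn Set.univ).real {x} = (Fintype.card X : ℝ)⁻¹ := fun x => by
    simp [measureReal_def, uniformOn_univ]
  rw [measureReal_def, Measure.prod_apply hs, ← integral_toReal
    (measurable_measure_prodMk_left hs).aemeasurable (Eventually.of_forall fun _ =>
      measure_lt_top _ _), integral_fintype .of_finite]
  simp only [hatom, smul_eq_mul, ← Finset.mul_sum, Fintype.expect_eq_sum_div_card,
    div_eq_inv_mul, measureReal_def]

open scoped Classical in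
lemma expect_measureReal_mul_card_le_count_le {ι X Y Ω : Type*} [Fintype ι] [Nontrivial ι]
    [AddGroup X] [Fintype X] [AddGroup Y] [Fintype Y] [MeasurableSpace Ω] (μ : Measure Ω)
    [IsProbabilityMeasure μ] (c : X →+ ι → Y)
    (hc : ∀ p q, p ≠ q → Function.Surjective fun x => (c x p, c x q))
    {E : ι → Y → Set Ω} (hE : ∀ p y, MeasurableSet (E p y)) {r : ι → ι → Prop} (hr : ∀ p, r p p)
    (hind : ∀ p q, ¬ r p q → ∀ y y', IndepSet (E p y) (E q y') μ) {δ θ : ℝ}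
    (hδ : ∀ p, 𝔼 y, μ.real (E p y) ≤ δ) (hθ : δ < θ) :
    𝔼 x, μ.real {ω | θ * Fintype.card ι ≤ #{p | ω ∈ E p (c x p)}} ≤
      #{p : ι × ι | r p.1 p.2} / ((θ - δ) * Fintype.card ι) ^ 2 := by
  let _ : MeasurableSpace X := ⊤
  have := isProbabilityMeasure_uniformOn (Ω := X) Set.finite_univ Set.univ_nonempty
  let Pr : Measure (X × Ω) := (uniformOn Set.univ).prod μ
  let A : ι → Set (X × Ω) := fun p => {a | a.2 ∈ E p (c a.1 p)}
  have hA : ∀ p, MeasurableSet (A p) := fun p => measurableSet_setOfPred.2 <|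
    measurable_from_prod_countable_right fun x => (hE p (c x p)).mem
  have hsurj : ∀ p, Function.Surjective fun x => c x p := fun p y => by
    obtain ⟨q, hq⟩ := exists_ne p
    obtain ⟨x, hx⟩ := hc p q hq.symm (y, 0)
    exact ⟨x, congrArg Prod.fst hx⟩
  have hAE : ∀ p, Pr.real (A p) = 𝔼 y, μ.real (E p y) := fun p =>
    (measureReal_uniformOn_univ_prod μ (hA p)).trans <|
      expect_comp_of_surjective ((Pi.evalAddMonoidHom _ p).comp c) (hsurj p) fun y => μ.real (E p y)
  have hindA : ∀ p q, ¬ r p q → IndepSet (A p) (A q) Pr := by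
    refine fun p q hpq => (indepSet_iff_measureReal_inter_eq_mul (hA p) (hA q)).2 ?_
    let c₂ : X →+ Y × Y := ((Pi.evalAddMonoidHom _ p).prod (Pi.evalAddMonoidHom _ q)).comp c
    have hc₂ : Function.Surjective c₂ := hc p q fun h => hpq (h ▸ hr p)
    calc Pr.real (A p ∩ A q)
        = 𝔼 x, μ.real (E p (c₂ x).1 ∩ E q (c₂ x).2) :=
          measureReal_uniformOn_univ_prod μ ((hA p).inter (hA q))
      _ = 𝔼 y : Y × Y, μ.real (E p y.1) * μ.real (E q y.2) := by
          rw [expect_comp_of_surjective c₂ hc₂ fun y => μ.real (E p y.1 ∩ E q y.2)]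
          refine Finset.expect_congr rfl fun y _ => ?_
          exact (indepSet_iff_measureReal_inter_eq_mul (hE p y.1) (hE q y.2)).1
            (hind p q hpq y.1 y.2)
      _ = _ := by rw [hAE, hAE, Finset.expect_mul_expect, ← Finset.univ_product_univ,
          Finset.expect_product]
  have hcount := measureReal_mul_card_le_count_le hA r hindA (fun p => (hAE p).trans_le (hδ p)) hθ
  refine (measureReal_uniformOn_univ_prod μ ?_).symm.trans_le hcount
  simp only [← sum_indicator_one_eq_card]
  exact measurableSet_le measurable_const
    (Finset.measurable_sum _ fun p _ => measurable_one.indicator (hA p))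

section RandomLinearMap

lemma ncard_mul_le_of_subset_biUnion {I α : Type*} [Finite I] [Finite α] {s : Set I} {A : Set α}
    {B : I → Set α} (hAB : A ⊆ ⋃ i ∈ s, B i) {c N : ℕ} (hB : ∀ i ∈ s, (B i).ncard * c ≤ N) :
    A.ncard * c ≤ s.ncard * N := by
  have hs : s.Finite := s.toFinite
  calc A.ncard * c ≤ (∑ i ∈ hs.toFinset, (B i).ncard) * c := by
        refine Nat.mul_le_mul_right _ (le_trans ?_ (Finset.set_ncard_biUnion_le _ _))
        exact Set.ncard_le_ncard (by simpa using hAB)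
    _ = ∑ i ∈ hs.toFinset, (B i).ncard * c := Finset.sum_mul ..
    _ ≤ #hs.toFinset * N :=
        Finset.sum_le_card_nsmul _ _ N fun i hi => hB i (hs.mem_toFinset.1 hi)
    _ = s.ncard * N := by rw [Set.ncard_eq_toFinset_card s hs]

variable {F κ Y Z : Type*} [Field F] [Fintype κ] [AddCommGroup Y] [Module F Y] [Finite Y]
  [AddCommGroup Z] [Module F Z]

lemma ncard_linearCombination_eq_mul_card {x : κ → F} (hx : x ≠ 0) (y : Y) :
    {G : κ → Y | Fintype.linearCombination F G x = y}.ncard * Nat.card Y = Nat.card (κ → Y) := by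
  classical
  obtain ⟨i, hi⟩ := Function.ne_iff.1 hx
  let eval : (κ → Y) →ₗ[F] Y := LinearMap.lsum F (fun _ => Y) F fun i => x i • LinearMap.id
  have heval : ∀ G, eval G = Fintype.linearCombination F G x := fun G => by
    simp [eval, Fintype.linearCombination_apply]
  have hsurj : Function.Surjective eval := fun y =>
    ⟨Pi.single i ((x i)⁻¹ • y), by simp [eval, Pi.single_apply, smul_smul, mul_inv_cancel₀ hi]⟩
  simp only [← heval]
  exact ncard_fiber_mul_card eval.toAddMonoidHom hsurj y

lemma ncard_exists_linearCombination_mem_mul_card_le [Finite F] (T : Set Y) :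
    {G : κ → Y | ∃ x : κ → F, x ≠ 0 ∧ Fintype.linearCombination F G x ∈ T}.ncard * Nat.card Y ≤
      Nat.card (κ → F) * T.ncard * Nat.card (κ → Y) := by
  let s : Set ((κ → F) × Y) := {x | x ≠ 0} ×ˢ T
  have hs : s.ncard ≤ Nat.card (κ → F) * T.ncard := by
    rw [Set.ncard_prod]
    exact Nat.mul_le_mul_right _ (Set.ncard_le_card _)
  refine (ncard_mul_le_of_subset_biUnion (s := s) (N := Nat.card (κ → Y))
    (B := fun p => {G | Fintype.linearCombination F G p.1 = p.2}) ?_ fun p hp =>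
      (ncard_linearCombination_eq_mul_card hp.1 p.2).le).trans (Nat.mul_le_mul_right _ hs)
  rintro G ⟨x, hx, hT⟩
  exact Set.mem_biUnion (x := (x, _)) ⟨hx, hT⟩ rfl

omit [Fintype κ] in
lemma ncard_forall_apply_eq_zero_mul_card [Finite κ] [Finite F] {f : Module.Dual F Y} (hf : f ≠ 0) :
    {G : κ → Y | ∀ i, f (G i) = 0}.ncard * Nat.card (κ → F) = Nat.card (κ → Y) := by
  have hsurj : Function.Surjective (f.compLeft κ) := (LinearMap.surjective hf).comp_left
  rw [← ncard_fiber_mul_card (f.compLeft κ).toAddMonoidHom hsurj 0]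
  simp [funext_iff]

lemma exists_dual_ne_zero_of_not_surjective {W : Type*} [AddCommGroup W] [Module F W]
    {g : W →ₗ[F] Z} (hg : ¬ Function.Surjective g) :
    ∃ f : Module.Dual F Z, f ≠ 0 ∧ ∀ w, f (g w) = 0 := by
  obtain ⟨f, hf, hle⟩ := Submodule.exists_le_ker_of_lt_top g.range
    (lt_top_iff_ne_top.2 fun h => hg (LinearMap.range_eq_top.1 h))
  exact ⟨f, hf, fun w => hle ⟨w, rfl⟩⟩

lemma natCard_dual [Finite F] [Finite Z] : Nat.card (Module.Dual F Z) = Nat.card Z := by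
  rw [Module.natCard_eq_pow_finrank (K := F), Subspace.dual_finrank_eq,
    ← Module.natCard_eq_pow_finrank]

lemma ncard_not_surjective_comp_linearCombination_mul_le [Finite F] [Finite Z] {g : Y →ₗ[F] Z}
    (hg : Function.Surjective g) :
    {G : κ → Y | ¬ Function.Surjective (g ∘ₗ Fintype.linearCombination F G)}.ncard *
      Nat.card (κ → F) ≤ Nat.card Z * Nat.card (κ → Y) := by
  classical
  have : Finite (Module.Dual F Z) := Module.finite_of_finite F
  let s : Set (Module.Dual F Z) := {f | f ≠ 0}
  have hs : s.ncard ≤ Nat.card Z := natCard_dual (F := F) (Z := Z) ▸ Set.ncard_le_card s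
  let B : Module.Dual F Z → Set (κ → Y) := fun f => {G | ∀ i, (f ∘ₗ g) (G i) = 0}
  have hB : ∀ f ∈ s, (B f).ncard * Nat.card (κ → F) ≤ Nat.card (κ → Y) := fun f hf =>
    (ncard_forall_apply_eq_zero_mul_card fun h => hf <| LinearMap.ext fun z => by
      obtain ⟨y, rfl⟩ := hg z
      exact LinearMap.congr_fun h y).le
  refine (ncard_mul_le_of_subset_biUnion (fun G hG => ?_) hB).trans (Nat.mul_le_mul_right _ hs)
  obtain ⟨f, hf, hzero⟩ := exists_dual_ne_zero_of_not_surjective hG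
  have hG : G ∈ B f := fun i => by simpa using hzero (Pi.single i 1)
  exact Set.mem_biUnion (x := f) hf hG

end RandomLinearMap

lemma ncard_hammingNorm_le {J S : Type*} [Fintype J] [Finite S] [DecidableEq S] [Zero S]
    (d : ℕ) : {y : J → S | hammingNorm y ≤ d}.ncard ≤ 2 ^ Nat.card J * Nat.card S ^ d := by
  classical
  have := Fintype.ofFinite S
  let supported : Finset J → Finset (J → S) := fun T =>
    Fintype.piFinset fun j => if j ∈ T then Finset.univ else {0}
  have hcover : ({y : J → S | hammingNorm y ≤ d} : Finset _) ⊆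
      ({T : Finset J | #T ≤ d} : Finset _).biUnion supported := by
    intro y hy
    refine Finset.mem_biUnion.2
      ⟨Finset.univ.filter fun j => y j ≠ 0, by simpa [hammingNorm] using hy, ?_⟩
    refine Fintype.mem_piFinset.2 fun j => ?_
    by_cases hj : y j = 0 <;> simp [hj]
  have hsupported : ∀ T ∈ ({T : Finset J | #T ≤ d} : Finset _),
      #(supported T) ≤ Fintype.card S ^ d := by
    intro T hT
    simp only [supported, Fintype.card_piFinset, apply_ite Finset.card, Finset.card_univ,
      Finset.card_singleton, Finset.prod_ite_mem, Finset.univ_inter, Finset.prod_const]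
    exact Nat.pow_le_pow_right (Fintype.card_pos_iff.2 ⟨0⟩) (Finset.mem_filter.1 hT).2
  rw [Set.ncard_eq_toFinset_card', Set.toFinset_ofPred, Nat.card_eq_fintype_card,
    Nat.card_eq_fintype_card]
  calc _ ≤ #{T : Finset J | #T ≤ d} * Fintype.card S ^ d :=
        (Finset.card_le_card hcover).trans (Finset.card_biUnion_le_card_mul _ _ _ hsupported)
    _ ≤ _ := by
        gcongr
        exact (Finset.card_le_univ _).trans_eq Fintype.card_finset

section LinearCode

variable {F κ J S : Type*} [Field F] [Finite F] [AddCommGroup S] [Module F S] [Finite S]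

lemma ncard_exists_not_surjective_pair_mul_le [Fintype κ] [Finite J] :
    {G : κ → J → S | ∃ j j', j ≠ j' ∧ ¬ Function.Surjective fun x : κ → F =>
        (Fintype.linearCombination F G x j, Fintype.linearCombination F G x j')}.ncard *
        Nat.card (κ → F) ≤
      Nat.card J ^ 2 * Nat.card S ^ 2 * Nat.card (κ → J → S) := by
  classical
  let g : J × J → (J → S) →ₗ[F] S × S := fun p => (LinearMap.proj p.1).prod (LinearMap.proj p.2)
  have hg : ∀ p : J × J, p.1 ≠ p.2 → Function.Surjective (g p) := by
    rintro ⟨j, j'⟩ hj ⟨y, y'⟩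
    exact ⟨Function.update (fun _ => y') j y, by simp [g, hj.symm]⟩
  let s : Set (J × J) := {p | p.1 ≠ p.2}
  have hs : s.ncard ≤ Nat.card J ^ 2 := by
    rw [sq, ← Nat.card_prod]
    exact Set.ncard_le_card s
  refine (ncard_mul_le_of_subset_biUnion (s := s) (B := fun p => {G | ¬ Function.Surjective
    (g p ∘ₗ Fintype.linearCombination F G)}) ?_ fun p hp =>
      ncard_not_surjective_comp_linearCombination_mul_le (hg p hp)).trans ?_
  · rintro G ⟨j, j', hj, hG⟩
    exact Set.mem_biUnion (x := (j, j')) hj hG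
  · rw [Nat.card_prod, ← sq, ← mul_assoc]
    gcongr

lemma exists_linearMap_lt_hammingNorm_and_surjective [Finite κ] [Fintype J] [DecidableEq S] {d : ℕ}
    (hd : 2 * (Nat.card (κ → F) * {y : J → S | hammingNorm y ≤ d}.ncard) < Nat.card (J → S))
    (hpair : 2 * (Nat.card J ^ 2 * Nat.card S ^ 2) ≤ Nat.card (κ → F)) :
    ∃ c : (κ → F) →ₗ[F] J → S, (∀ x ≠ 0, d < hammingNorm (c x)) ∧
      ∀ j j', j ≠ j' → Function.Surjective fun x => (c x j, c x j') := by
  have := Fintype.ofFinite κ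
  by_contra! hcon
  let A : Set (κ → J → S) := {G | ∃ x : κ → F, x ≠ 0 ∧
    Fintype.linearCombination F G x ∈ {y : J → S | hammingNorm y ≤ d}}
  let B : Set (κ → J → S) := {G | ∃ j j', j ≠ j' ∧ ¬ Function.Surjective fun x : κ → F =>
    (Fintype.linearCombination F G x j, Fintype.linearCombination F G x j')}
  have hcover : A ∪ B = Set.univ := Set.eq_univ_of_forall fun G => by
    by_contra! hG
    rw [Set.mem_union, not_or] at hG
    refine hG.2 (hcon (Fintype.linearCombination F G) fun x hx => ?_)
    by_contra! hle
    exact hG.1 ⟨x, hx, hle⟩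
  have hcard : Nat.card (κ → J → S) ≤ A.ncard + B.ncard := by
    rw [← Set.ncard_univ, ← hcover]
    exact Set.ncard_union_le A B
  have hA : 2 * A.ncard < Nat.card (κ → J → S) := by
    refine Nat.lt_of_mul_lt_mul_right (a := Nat.card (J → S)) ?_
    calc _ = 2 * (A.ncard * Nat.card (J → S)) := mul_assoc ..
      _ ≤ 2 * (Nat.card (κ → F) * {y : J → S | hammingNorm y ≤ d}.ncard *
            Nat.card (κ → J → S)) :=
          Nat.mul_le_mul_left _ (ncard_exists_linearCombination_mem_mul_card_le _)
      _ < Nat.card (κ → J → S) * Nat.card (J → S) := by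
          rw [← mul_assoc, mul_comm (Nat.card (κ → J → S))]
          exact Nat.mul_lt_mul_of_pos_right hd Nat.card_pos
  have hB : 2 * B.ncard ≤ Nat.card (κ → J → S) := by
    refine Nat.le_of_mul_le_mul_right (c := Nat.card (κ → F)) ?_ Nat.card_pos
    calc _ = 2 * (B.ncard * Nat.card (κ → F)) := mul_assoc ..
      _ ≤ 2 * (Nat.card J ^ 2 * Nat.card S ^ 2 * Nat.card (κ → J → S)) :=
          Nat.mul_le_mul_left _ ncard_exists_not_surjective_pair_mul_le
      _ ≤ Nat.card (κ → J → S) * Nat.card (κ → F) := by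
          rw [← mul_assoc, mul_comm (Nat.card (κ → J → S))]
          exact Nat.mul_le_mul_right _ hpair
  omega

end LinearCode

/-- A binary linear code with coordinates in `J` that corrects `e` errors and whose pairs of
coordinates are uniform, together with embeddings of the messages `B` into its domain and of its
coordinate values into the symbols `A`. The powers of two `2 ^ dim` and `2 ^ symbolDim` match
`card B` and `card A` up to a factor of two, so passing between the two sides costs a factor of two
in averages. -/
structure OuterCode (J A B : Type*) [Fintype J] [Fintype A] [Fintype B] (e : ℕ) where
  /-- The dimension of the code over `ZMod 2`. -/
  dim : ℕ
  /-- The number of bits in a coordinate of a codeword. -/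
  symbolDim : ℕ
  /-- The linear code. -/
  code : (Fin dim → ZMod 2) →ₗ[ZMod 2] J → Fin symbolDim → ZMod 2
  lt_hammingNorm_code : ∀ x ≠ 0, 2 * e < hammingNorm (code x)
  surjective_pair : ∀ j j', j ≠ j' → Function.Surjective fun x => (code x j, code x j')
  /-- The embedding of the messages. -/
  message : B ↪ Fin dim → ZMod 2
  /-- The embedding of the bit strings that occur as coordinates. -/
  symbol : (Fin symbolDim → ZMod 2) ↪ A
  two_pow_dim_le : 2 ^ dim ≤ 2 * Fintype.card B
  card_le_two_pow_symbolDim : Fintype.card A ≤ 2 * 2 ^ symbolDim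

namespace OuterCode

variable {J A B : Type*} [Fintype J] [Fintype A] [Fintype B] {e : ℕ}

/-- The codeword of a message, as a word in the symbols `A`. -/
def encode (O : OuterCode J A B e) (w : B) (j : J) : A :=
  O.symbol (O.code (O.message w) j)

lemma nonempty (O : OuterCode J A B e) : Nonempty B := by
  have h : 0 < 2 ^ O.dim := by positivity
  exact Fintype.card_pos_iff.1 (by have := O.two_pow_dim_le; omega)

variable [DecidableEq A]

lemma lt_hammingDist_encode (O : OuterCode J A B e) {w w' : B} (h : w ≠ w') :
    2 * e < hammingDist (O.encode w) (O.encode w') := by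
  have hne : -O.message w + O.message w' ≠ 0 := fun h0 =>
    h (O.message.injective (neg_add_eq_zero.1 h0))
  have hcode := O.lt_hammingNorm_code _ hne
  rw [map_add, map_neg, ← hammingDist_eq_hammingNorm] at hcode
  exact hcode.trans_eq (hammingDist_comp (fun _ => O.symbol) fun _ => O.symbol.injective).symm

/-- Bounded distance decoding; the value is arbitrary where no codeword is within distance `e`. -/
noncomputable def decode (O : OuterCode J A B e) (y : J → A) : B :=
  have := O.nonempty
  Classical.epsilon fun w => hammingDist (O.encode w) y ≤ e

lemma decode_eq (O : OuterCode J A B e) {w : B} {y : J → A}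
    (h : hammingDist (O.encode w) y ≤ e) : O.decode y = w := by
  have hdecode : hammingDist (O.encode (O.decode y)) y ≤ e :=
    Classical.epsilon_spec (p := fun w => hammingDist (O.encode w) y ≤ e) ⟨w, h⟩
  by_contra hne
  have htriangle := hammingDist_triangle (O.encode (O.decode y)) y (O.encode w)
  rw [hammingDist_comm y] at htriangle
  have := O.lt_hammingDist_encode hne
  omega

end OuterCode
lemma card_fin_zmod_two (d : ℕ) : Fintype.card (Fin d → ZMod 2) = 2 ^ d := by
  rw [Fintype.card_fun, ZMod.card, Fintype.card_fin]

lemma exists_linearMap_zmod_two_lt_hammingNorm_and_surjective {J : Type*} [Fintype J] {K a e : ℕ}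
    (hK : K + Fintype.card J + a * (2 * e) + 1 < a * Fintype.card J)
    (hK' : 2 * Fintype.card J + 2 * a + 1 ≤ K) :
    ∃ c : (Fin K → ZMod 2) →ₗ[ZMod 2] J → Fin a → ZMod 2,
      (∀ x ≠ 0, 2 * e < hammingNorm (c x)) ∧
        ∀ j j', j ≠ j' → Function.Surjective fun x => (c x j, c x j') := by
  have hcard : ∀ d : ℕ, Nat.card (Fin d → ZMod 2) = 2 ^ d := fun d =>
    Nat.card_eq_fintype_card.trans (card_fin_zmod_two d)
  apply exists_linearMap_lt_hammingNorm_and_surjective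
  · calc 2 * (Nat.card (Fin K → ZMod 2) * {y : J → Fin a → ZMod 2 | hammingNorm y ≤ 2 * e}.ncard)
        ≤ 2 * (2 ^ K * (2 ^ Fintype.card J * (2 ^ a) ^ (2 * e))) := by
          rw [hcard]
          gcongr
          simpa only [hcard, Nat.card_eq_fintype_card] using
            ncard_hammingNorm_le (J := J) (S := Fin a → ZMod 2) (2 * e)
      _ = 2 ^ (K + Fintype.card J + a * (2 * e) + 1) := by ring
      _ < 2 ^ (a * Fintype.card J) := Nat.pow_lt_pow_right one_lt_two hK
      _ = Nat.card (J → Fin a → ZMod 2) := by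
          rw [Nat.card_fun, hcard, Nat.card_eq_fintype_card, pow_mul]
  · calc 2 * (Nat.card J ^ 2 * Nat.card (Fin a → ZMod 2) ^ 2)
        ≤ 2 * ((2 ^ Fintype.card J) ^ 2 * (2 ^ a) ^ 2) := by
          rw [hcard, Nat.card_eq_fintype_card]
          gcongr
          exact Nat.lt_two_pow_self.le
      _ = 2 ^ (2 * Fintype.card J + 2 * a + 1) := by ring
      _ ≤ 2 ^ K := Nat.pow_le_pow_right two_pos hK'
      _ = _ := (hcard K).symm

lemma two_pow_clog_two_le {M : ℕ} (hM : 0 < M) : 2 ^ Nat.clog 2 M ≤ 2 * M := by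
  rcases h : Nat.clog 2 M with _ | k
  · omega
  · have hk : 2 ^ k < M := Nat.pow_lt_of_lt_clog (h ▸ k.lt_succ_self)
    rw [pow_succ]
    omega

section Existence

variable {J A B : Type*} [Fintype J] [Fintype A] [Fintype B] {e a K : ℕ} [Nonempty A] [Nonempty B]

lemma nonempty_outerCode_of_linearMap (ha : Nat.log 2 (Fintype.card A) = a)
    (hK : Nat.clog 2 (Fintype.card B) = K) {c : (Fin K → ZMod 2) →ₗ[ZMod 2] J → Fin a → ZMod 2}
    (hc : ∀ x ≠ 0, 2 * e < hammingNorm (c x))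
    (hpair : ∀ j j', j ≠ j' → Function.Surjective fun x => (c x j, c x j')) :
    Nonempty (OuterCode J A B e) := by
  subst ha hK
  obtain ⟨message⟩ : Nonempty (B ↪ Fin (Nat.clog 2 (Fintype.card B)) → ZMod 2) :=
    Function.Embedding.nonempty_of_card_le ((Nat.le_pow_clog one_lt_two _).trans_eq
      (card_fin_zmod_two _).symm)
  obtain ⟨symbol⟩ : Nonempty ((Fin (Nat.log 2 (Fintype.card A)) → ZMod 2) ↪ A) :=
    Function.Embedding.nonempty_of_card_le
      ((card_fin_zmod_two _).trans_le (Nat.pow_log_le_self 2 Fintype.card_ne_zero))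
  exact ⟨⟨_, _, c, hc, hpair, message, symbol, two_pow_clog_two_le Fintype.card_pos,
    (Nat.lt_pow_succ_log_self one_lt_two _).le.trans_eq (pow_succ' _ _)⟩⟩

theorem nonempty_outerCode (ha : Nat.log 2 (Fintype.card A) = a)
    (hK : Nat.clog 2 (Fintype.card B) = K)
    (h : a = 0 ∧ K = 0 ∨ K + Fintype.card J + a * (2 * e) + 1 < a * Fintype.card J ∧
      2 * Fintype.card J + 2 * a + 1 ≤ K) : Nonempty (OuterCode J A B e) := by
  rcases h with ⟨rfl, rfl⟩ | ⟨h, h'⟩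
  · exact nonempty_outerCode_of_linearMap ha hK (c := 0)
      (fun x hx => (hx (Subsingleton.elim x 0)).elim) fun _ _ _ y => ⟨0, Subsingleton.elim _ y⟩
  · obtain ⟨c, hc, hpair⟩ := exists_linearMap_zmod_two_lt_hammingNorm_and_surjective h h'
    exact nonempty_outerCode_of_linearMap ha hK hc hpair

end Existence

lemma expect_comp_embedding_le {Y W : Type*} [Fintype Y] [Fintype W] [Nonempty Y] (e : Y ↪ W)
    {f : W → ℝ} (hf : ∀ w, 0 ≤ f w) {c : ℝ} (hc : Fintype.card W ≤ c * Fintype.card Y) :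
    𝔼 y, f (e y) ≤ c * 𝔼 w, f w := by
  have := Nonempty.map e ‹_›
  have hY : (0 : ℝ) < Fintype.card Y := Nat.cast_pos.2 Fintype.card_pos
  have hW : (0 : ℝ) < Fintype.card W := Nat.cast_pos.2 Fintype.card_pos
  have hsum : ∑ y, f (e y) ≤ ∑ w, f w := by
    rw [← Finset.sum_map Finset.univ e f]
    exact Finset.sum_le_univ_sum_of_nonneg hf
  rw [Fintype.expect_eq_sum_div_card, Fintype.expect_eq_sum_div_card, mul_div_assoc',
    div_le_div_iff₀ hY hW]
  calc (∑ y, f (e y)) * Fintype.card W ≤ (∑ w, f w) * (c * Fintype.card Y) := by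
        gcongr
        exact Finset.sum_nonneg fun w _ => hf w
    _ = c * (∑ w, f w) * Fintype.card Y := by ring

lemma expect_comp_piCongrRight_le {L : ℕ} {Y W : Fin L → Type*} [∀ i, Fintype (Y i)]
    [∀ i, Fintype (W i)] [∀ i, Nonempty (Y i)] (e : ∀ i, Y i ↪ W i)
    (hcard : ∀ i, Fintype.card (W i) ≤ 2 * Fintype.card (Y i)) {f : (∀ i, W i) → ℝ}
    (hf : ∀ w, 0 ≤ f w) : 𝔼 y : ∀ i, Y i, f (fun i => e i (y i)) ≤ 2 ^ L * 𝔼 w, f w := by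
  refine expect_comp_embedding_le (Function.Embedding.piCongrRight e) hf ?_
  calc (Fintype.card (∀ i, W i) : ℝ) ≤ ∏ i, (2 * Fintype.card (Y i) : ℝ) := by
        rw [Fintype.card_pi, Nat.cast_prod]
        exact Finset.prod_le_prod (fun _ _ => Nat.cast_nonneg _) fun i _ => by
          exact_mod_cast hcard i
    _ = 2 ^ L * Fintype.card (∀ i, Y i) := by
        rw [Finset.prod_mul_distrib, Finset.prod_const, Finset.card_univ, Fintype.card_fin,
          Fintype.card_pi, Nat.cast_prod]

open scoped Classical in
lemma card_fst_eq_fst_le (κ β : Type*) [Fintype κ] [Fintype β] :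
    #{p : (κ × β) × (κ × β) | p.1.1 = p.2.1} ≤ Fintype.card κ * Fintype.card β ^ 2 := by
  calc #{p : (κ × β) × (κ × β) | p.1.1 = p.2.1}
      ≤ #(Finset.univ : Finset (κ × β × β)) := by
        refine Finset.card_le_card_of_injOn (fun p => (p.1.1, p.1.2, p.2.2))
          (fun _ _ => Finset.mem_coe.2 (Finset.mem_univ _)) ?_
        rintro ⟨⟨g, j⟩, g', j'⟩ h ⟨⟨g₁, j₁⟩, g₁', j₁'⟩ h₁ heq
        simp_all
    _ = _ := by simp [sq]

namespace OuterCode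

variable {L : ℕ} {J : Type*} [Fintype J] {A B : Fin L → Type*} [∀ i, Fintype (A i)]
  [∀ i, Fintype (B i)] {e : ℕ}

/-- The product of the outer codes of the `L` sources, one coordinate of `J` at a time. -/
def codes (O : ∀ i, OuterCode J (A i) (B i) e) :
    (∀ i, Fin (O i).dim → ZMod 2) →+ J → ∀ i, Fin (O i).symbolDim → ZMod 2 where
  toFun x j i := (O i).code (x i) j
  map_zero' := by
    ext1 j
    ext1 i
    simp only [Pi.zero_apply, map_zero]
  map_add' x y := by
    ext1 j
    ext1 i
    simp only [Pi.add_apply, map_add]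

lemma surjective_codes_pair (O : ∀ i, OuterCode J (A i) (B i) e) {j j' : J} (hj : j ≠ j') :
    Function.Surjective fun x => (codes O x j, codes O x j') := by
  rintro ⟨y, y'⟩
  choose x hx using fun i => (O i).surjective_pair j j' hj (y i, y' i)
  exact ⟨x, Prod.ext (funext fun i => congrArg Prod.fst (hx i))
    (funext fun i => congrArg Prod.snd (hx i))⟩

end OuterCode

namespace CodingScheme

variable {V : Type*} [Fintype V] {L : ℕ} {N : UnicastNetwork V L} {P : ℝ} {n : ℕ} {R : Fin L → ℝ}
  {κ β : Type*} [Fintype κ] [Fintype β] [DecidableEq β] {m : ℕ} {Q : Matrix β β ℝ}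
  {R' : Fin L → ℝ} {e : ℕ}

/-- The interleaving of `C` whose outer encoders and decoders are those of the outer codes `O`. -/
noncomputable def interleaveCodes (C : CodingScheme N P n R) (S : Schedule κ β n m)
    (hQ : Q * Qᵀ = 1)
    (O : ∀ i, OuterCode (κ × β) (MessageSet n (R i)) (MessageSet m (R' i)) e) :
    CodingScheme N P m R' :=
  C.interleave S hQ (fun i => (O i).encode) fun i => (O i).decode

open scoped Classical in
/-- The copies of `C` that decode incorrectly when the messages have the images `x` in the domains
of the outer codes `O` and the noise over the whole block is `z`. -/
noncomputable def failedCopies (C : CodingScheme N P n R) (S : Schedule κ β n m)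
    (Q : Matrix β β ℝ) (O : ∀ i, OuterCode (κ × β) (MessageSet n (R i)) (MessageSet m (R' i)) e)
    (x : ∀ i, Fin (O i).dim → ZMod 2) (z : V × Fin m → ℝ) : Finset (κ × β) :=
  {q | S.innerNoise Q z q ∈ C.errorSet fun i => (O i).symbol ((O i).code (x i) q)}

lemma lt_card_failedCopies (C : CodingScheme N P n R) (S : Schedule κ β n m) (hQ : Q * Qᵀ = 1)
    (O : ∀ i, OuterCode (κ × β) (MessageSet n (R i)) (MessageSet m (R' i)) e)
    {w : (i : Fin L) → MessageSet m (R' i)} {z : V × Fin m → ℝ}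
    (hz : z ∈ (C.interleaveCodes S hQ O).errorSet w) :
    e < #(C.failedCopies S Q O (fun i => (O i).message (w i)) z) := by
  classical
  obtain ⟨i, hi⟩ := (C.mem_errorSet_interleave S hQ _ _ w z).1 hz
  refine (not_le.1 fun hle => hi ((O i).decode_eq hle).symm).trans_le ?_
  refine Finset.card_le_card fun q hq => ?_
  exact Finset.mem_filter.2 ⟨Finset.mem_univ q, i, (Finset.mem_filter.1 hq).2⟩

variable (C : CodingScheme N P n R) (S : Schedule κ β n m)
  (O : ∀ i, OuterCode (κ × β) (MessageSet n (R i)) (MessageSet m (R' i)) e)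
  {ν : V → Measure ℝ} [∀ v, IsProbabilityMeasure (ν v)] {δ θ : ℝ}

omit [Fintype κ] [DecidableEq β] in
lemma measureReal_innerNoise_mem_errorSet (q : κ × β) (w : (i : Fin L) → MessageSet n (R i)) :
    (noiseLaw ν m).real {z | S.innerNoise Q z q ∈ C.errorSet w} =
      (noiseLaw (fun v => weightedSumLaw (ν v) (Q q.2)) n).real (C.errorSet w) := by
  rw [← S.map_innerNoise, map_measureReal_apply (S.measurable_innerNoise Q q)
    (C.measurableSet_errorSet w)]
  rfl

omit [DecidableEq β] in
lemma expect_measureReal_innerNoise_mem_errorSet_le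
    (hδ : ∀ j, C.errorProb (fun v => weightedSumLaw (ν v) (Q j)) ≤ δ) (q : κ × β) :
    𝔼 y : ∀ i, Fin (O i).symbolDim → ZMod 2, (noiseLaw ν m).real
      {z | S.innerNoise Q z q ∈ C.errorSet fun i => (O i).symbol (y i)} ≤ 2 ^ L * δ := by
  refine (expect_comp_piCongrRight_le (fun i => (O i).symbol)
    (fun i => (O i).card_le_two_pow_symbolDim.trans_eq (congrArg _ (card_fin_zmod_two _).symm))
    (f := fun w => (noiseLaw ν m).real {z | S.innerNoise Q z q ∈ C.errorSet w})
    fun _ => measureReal_nonneg).trans ?_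
  simp only [measureReal_innerNoise_mem_errorSet, ← errorProb_eq_expect]
  gcongr
  exact hδ q.2

lemma measureReal_errorSet_interleaveCodes_le (hQ : Q * Qᵀ = 1)
    (he : θ * Fintype.card (κ × β) ≤ e + 1) (w : (i : Fin L) → MessageSet m (R' i)) :
    (noiseLaw ν m).real ((C.interleaveCodes S hQ O).errorSet w) ≤ (noiseLaw ν m).real
      {z | θ * Fintype.card (κ × β) ≤
        #(C.failedCopies S Q O (fun i => (O i).message (w i)) z)} := by
  refine measureReal_mono fun z hz => he.trans ?_
  exact_mod_cast C.lt_card_failedCopies S hQ O hz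

variable [Nontrivial κ] [Nonempty β]

omit [DecidableEq β] in
lemma expect_measureReal_le_card_failedCopies_le
    (hδ : ∀ j, C.errorProb (fun v => weightedSumLaw (ν v) (Q j)) ≤ δ) (hθ : 2 ^ L * δ < θ) :
    𝔼 x, (noiseLaw ν m).real
        {z | θ * Fintype.card (κ × β) ≤ #(C.failedCopies S Q O x z)} ≤
      1 / (Fintype.card κ * (θ - 2 ^ L * δ) ^ 2) := by
  classical
  let E : κ × β → (∀ i, Fin (O i).symbolDim → ZMod 2) → Set (V × Fin m → ℝ) := fun q y =>
    {z | S.innerNoise Q z q ∈ C.errorSet fun i => (O i).symbol (y i)}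
  have hE : ∀ q y, MeasurableSet (E q y) := fun q y =>
    S.measurable_innerNoise Q q (C.measurableSet_errorSet _)
  have hind : ∀ p q : κ × β, ¬ p.1 = q.1 → ∀ y y', IndepSet (E p y) (E q y') (noiseLaw ν m) :=
    fun p q hpq y y' => (indepFun_iff_indepSet_preimage (S.measurable_innerNoise Q p)
      (S.measurable_innerNoise Q q)).1 (S.indepFun_innerNoise Q ν hpq) _ _
        (C.measurableSet_errorSet _) (C.measurableSet_errorSet _)
  have hcount := expect_measureReal_mul_card_le_count_le (noiseLaw ν m) (OuterCode.codes O)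
    (fun p q => OuterCode.surjective_codes_pair O) hE (r := fun p q => p.1 = q.1) (fun _ => rfl)
    hind (C.expect_measureReal_innerNoise_mem_errorSet_le S O hδ) hθ
  refine hcount.trans ?_
  calc _ ≤ (Fintype.card κ * Fintype.card β ^ 2 : ℝ) /
        ((θ - 2 ^ L * δ) * Fintype.card (κ × β)) ^ 2 := by
        gcongr
        exact_mod_cast card_fst_eq_fst_le κ β
    _ = 1 / (Fintype.card κ * (θ - 2 ^ L * δ) ^ 2) := by
        have := sub_pos.2 hθ
        rw [Fintype.card_prod]
        push_cast
        field_simp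

theorem errorProb_interleaveCodes_le (hQ : Q * Qᵀ = 1)
    (hδ : ∀ j, C.errorProb (fun v => weightedSumLaw (ν v) (Q j)) ≤ δ) (hθ : 2 ^ L * δ < θ)
    (he : θ * Fintype.card (κ × β) ≤ e + 1) :
    (C.interleaveCodes S hQ O).errorProb ν ≤
      2 ^ L / (Fintype.card κ * (θ - 2 ^ L * δ) ^ 2) := by
  have := fun i => (O i).nonempty
  rw [errorProb_eq_expect, ← mul_one_div]
  have herror := C.measureReal_errorSet_interleaveCodes_le S O (ν := ν) hQ he
  calc 𝔼 w, (noiseLaw ν m).real ((C.interleaveCodes S hQ O).errorSet w)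
      ≤ 𝔼 w : ∀ i, MessageSet m (R' i), (noiseLaw ν m).real {z | θ * Fintype.card (κ × β) ≤
          #(C.failedCopies S Q O (fun i => (O i).message (w i)) z)} :=
        Finset.expect_le_expect fun w _ => herror w
    _ ≤ 2 ^ L * 𝔼 x, (noiseLaw ν m).real
          {z | θ * Fintype.card (κ × β) ≤ #(C.failedCopies S Q O x z)} :=
        expect_comp_piCongrRight_le (fun i => (O i).message)
          (fun i => (card_fin_zmod_two _).trans_le (O i).two_pow_dim_le)
          (f := fun x => (noiseLaw ν m).real
            {z | θ * Fintype.card (κ × β) ≤ #(C.failedCopies S Q O x z)})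
          fun _ => measureReal_nonneg
    _ ≤ _ := by
        gcongr
        exact C.expect_measureReal_le_card_failedCopies_le S O hδ hθ

end CodingScheme

lemma exists_isHadamard_two_pow (s : ℕ) :
    ∃ H : Matrix (Fin (2 ^ s)) (Fin (2 ^ s)) ℝ, H.IsHadamard := by
  induction s with
  | zero => exact ⟨1, by constructor <;> simp [Matrix.one_apply, Unitary.mem_iff]⟩
  | succ s ih =>
    obtain ⟨H, hH⟩ := ih
    have h2 : (!![1, 1; 1, -1] : Matrix (Fin 2) (Fin 2) ℝ).IsHadamard := by
      constructor
      · intro i j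
        fin_cases i <;> fin_cases j <;> simp [Unitary.mem_iff]
      all_goals
        ext i j
        fin_cases i <;> fin_cases j <;>
          norm_num [Matrix.mul_apply, Fin.sum_univ_two, Matrix.conjTranspose_apply]
    exact ⟨_, (hH.kronecker h2).reindex finProdFinEquiv finProdFinEquiv⟩

lemma exists_mul_transpose_eq_one_and_abs_apply_eq (s : ℕ) :
    ∃ Q : Matrix (Fin (2 ^ s)) (Fin (2 ^ s)) ℝ,
      Q * Qᵀ = 1 ∧ ∀ i j, |Q i j| = (√(2 ^ s : ℕ))⁻¹ := by
  obtain ⟨H, hH⟩ := exists_isHadamard_two_pow s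
  refine ⟨(√(2 ^ s : ℕ))⁻¹ • H, ?_, fun i j => ?_⟩
  · have hmul := hH.mul_conjTranspose
    rw [Matrix.conjTranspose_eq_transpose_of_trivial] at hmul
    rw [Matrix.transpose_smul, Matrix.smul_mul, Matrix.mul_smul, hmul, smul_smul, smul_smul,
      Fintype.card_fin, ← mul_inv, Real.mul_self_sqrt (by positivity),
      inv_mul_cancel₀ (by positivity), one_smul]
  · have hentry : |H i j| = 1 := by
      have := (Unitary.mem_iff.1 (hH.apply_mem i j)).1
      rw [star_trivial, ← sq] at this
      exact (abs_eq zero_le_one).2 (sq_eq_one_iff.1 this)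
    rw [Matrix.smul_apply, smul_eq_mul, abs_mul, hentry, mul_one, abs_of_nonneg (by positivity)]

lemma log_floor_two_rpow {u : ℝ} (hu : 0 ≤ u) : Nat.log 2 ⌊(2 : ℝ) ^ u⌋₊ = ⌊u⌋₊ := by
  have h := Real.floor_logb_natCast (b := 2) (r := (2 : ℝ) ^ u) (by positivity)
  rw [Nat.cast_ofNat, Real.logb_rpow two_pos (by norm_num),
    Int.log_of_one_le_right 2 (Real.one_le_rpow one_le_two hu)] at h
  exact_mod_cast h.symm.trans (Int.natCast_floor_eq_floor hu).symm

lemma clog_le_log_add_one (b M : ℕ) : Nat.clog b M ≤ Nat.log b M + 1 := by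
  rcases Nat.lt_or_ge 1 b with hb | hb
  · exact Nat.clog_le_of_le_pow (Nat.lt_pow_succ_log_self hb M).le
  · rw [Nat.clog_of_left_le_one hb]
    exact Nat.zero_le _

lemma outerCode_parameters {u v η : ℝ} {K T e : ℕ} (hη : 0 < η) (hη' : η ≤ 1 / 2)
    (hu : 12 ≤ η * u) (hT : 16 ≤ T) (hK : ⌊v⌋₊ ≤ K) (hK' : K ≤ ⌊v⌋₊ + 1)
    (hv : u * T / 2 ≤ v) (hv' : v ≤ (1 - η / 2) * (u * T)) (he : e ≤ η / 8 * T) :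
    K + T + ⌊u⌋₊ * (2 * e) + 1 < ⌊u⌋₊ * T ∧ 2 * T + 2 * ⌊u⌋₊ + 1 ≤ K := by
  have hu24 : 24 ≤ u := by nlinarith
  have hT16 : (16 : ℝ) ≤ T := by exact_mod_cast hT
  have ha : (⌊u⌋₊ : ℝ) ≤ u := Nat.floor_le (by linarith)
  have ha' := Nat.lt_floor_add_one u
  have hKv : (K : ℝ) ≤ v + 1 := by
    have := Nat.floor_le (show 0 ≤ v from le_trans (by positivity) hv)
    have : (K : ℝ) ≤ ⌊v⌋₊ + 1 := by exact_mod_cast hK'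
    linarith
  have hvK : v < K + 1 := (Nat.lt_floor_add_one v).trans_le (by gcongr)
  generalize ⌊u⌋₊ = a at *
  constructor
  · have hreal : (K : ℝ) + T + a * (2 * e) + 1 < a * T := by
      have h1 : (a : ℝ) * e ≤ a * (η / 8 * T) := by gcongr
      have h2 : (u - 1) * (T * (1 - η / 4)) ≤ a * (T * (1 - η / 4)) := by
        have : 0 ≤ T * (1 - η / 4) := mul_nonneg (by linarith) (by linarith)
        have : u - 1 ≤ a := by linarith
        gcongr
      have h3 : 12 * T ≤ η * u * T := by gcongr
      have h4 : 0 ≤ T * η := by positivity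
      nlinarith only [h1, h2, h3, h4, hT16, hη', hKv, hv', he]
    exact_mod_cast hreal
  · have hreal : 2 * T + 2 * a + 1 ≤ (K : ℝ) := by
      nlinarith [mul_nonneg (sub_nonneg.2 hu24) (sub_nonneg.2 hT16)]
    exact_mod_cast hreal

lemma rate_bounds {R η : ℝ} {n m k b : ℕ} (hR : 0 ≤ R) (hη' : η ≤ 1 / 2) (hk : 2 ≤ η * k)
    (hm : k * (n * b) ≤ m) (hm' : m ≤ (k + 1) * (n * b)) :
    n * R * (k * b : ℕ) / 2 ≤ m * ((1 - η) * R) ∧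
      m * ((1 - η) * R) ≤ (1 - η / 2) * (n * R * (k * b : ℕ)) := by
  have hη : 0 ≤ η := by
    by_contra! hneg
    exact absurd hk (by nlinarith [k.cast_nonneg (α := ℝ)])
  have hrate : 0 ≤ (1 - η) * R := mul_nonneg (by linarith) hR
  push_cast
  constructor
  · calc n * R * (k * b) / 2 = k * (n * b * R) * (1 / 2) := by ring
      _ ≤ k * (n * b * R) * (1 - η) := by gcongr; linarith
      _ = (k * (n * b) : ℕ) * ((1 - η) * R) := by push_cast; ring
      _ ≤ m * ((1 - η) * R) := by gcongr
  · calc (m : ℝ) * ((1 - η) * R) ≤ ((k + 1) * (n * b) : ℕ) * ((1 - η) * R) := by gcongr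
      _ = ((k + 1) * (1 - η)) * (n * b * R) := by push_cast; ring
      _ ≤ ((1 - η / 2) * k) * (n * b * R) := by
        have hfactor : (k + 1) * (1 - η) ≤ (1 - η / 2) * k := by linarith
        gcongr
      _ = (1 - η / 2) * (n * R * (k * b)) := by ring

lemma messageSet_nonempty {n : ℕ} {r : ℝ} (hr : 0 ≤ r) : Nonempty (MessageSet n r) :=
  ⟨⟨0, Nat.floor_pos.2 (Real.one_le_rpow one_le_two (by positivity))⟩⟩

lemma nonempty_outerCode_messageSet {R η : ℝ} {n m k b e : ℕ} (hR : 0 ≤ R) (hη : 0 < η)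
    (hη' : η ≤ 1 / 2) (hnR : R = 0 ∨ 12 ≤ η * (n * R)) (hk : 16 ≤ k) (hkη : 2 ≤ η * k)
    (hb : 0 < b) (hm : k * (n * b) ≤ m) (hm' : m ≤ (k + 1) * (n * b)) (he : e ≤ η / 8 * (k * b)) :
    Nonempty (OuterCode (Fin k × Fin b) (MessageSet n R) (MessageSet m ((1 - η) * R)) e) := by
  have hR' : 0 ≤ (1 - η) * R := mul_nonneg (by linarith) hR
  have := messageSet_nonempty (n := n) hR
  have := messageSet_nonempty (n := m) hR'
  refine nonempty_outerCode rfl rfl ?_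
  rw [Fintype.card_fin, Fintype.card_fin, Fintype.card_prod, Fintype.card_fin, Fintype.card_fin]
  rcases hnR with rfl | hnR
  · left
    simp
  · right
    obtain ⟨hv, hv'⟩ := rate_bounds hR hη' hkη hm hm'
    have hlog := log_floor_two_rpow (u := m * ((1 - η) * R)) (by positivity)
    rw [log_floor_two_rpow (by positivity)]
    exact outerCode_parameters hη hη' hnR (by nlinarith) (hlog.symm.trans_le (Nat.log_le_clog _ _))
      ((clog_le_log_add_one _ _).trans_eq (congrArg (· + 1) hlog)) hv hv'
      (he.trans_eq (by push_cast; ring))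

/-- The number of copies of an inner code that are mixed with each other within a block of length
`m`: a power of two of order `√m`, so that both it and the number of groups tend to infinity. -/
def groupSize (m : ℕ) : ℕ :=
  2 ^ (Nat.log 2 m / 2)

/-- The number of groups of `groupSize m` copies of an inner code of length `n` that fit into a
block of length `m`. -/
def groupCount (n m : ℕ) : ℕ :=
  m / (n * groupSize m)

lemma groupSize_pos (m : ℕ) : 0 < groupSize m :=
  Nat.two_pow_pos _

lemma groupCount_mul_le (n m : ℕ) : groupCount n m * (n * groupSize m) ≤ m :=
  Nat.div_mul_le_self _ _

lemma le_groupCount_add_one_mul {n : ℕ} (hn : 0 < n) (m : ℕ) :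
    m ≤ (groupCount n m + 1) * (n * groupSize m) :=
  (Nat.lt_mul_of_div_lt (Nat.lt_succ_self _) (Nat.mul_pos hn (groupSize_pos m))).le

lemma tendsto_groupSize : Tendsto groupSize atTop atTop := by
  refine tendsto_atTop.2 fun B => ?_
  filter_upwards [eventually_ge_atTop (2 ^ (2 * B))] with m hm
  have hlog : 2 * B ≤ Nat.log 2 m :=
    (Nat.log_pow one_lt_two (2 * B)).symm.trans_le (Nat.log_mono_right hm)
  exact Nat.lt_two_pow_self.le.trans (Nat.pow_le_pow_right two_pos (by omega))

lemma groupSize_mul_self_le {m : ℕ} (hm : m ≠ 0) : groupSize m * groupSize m ≤ m :=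
  calc groupSize m * groupSize m = 2 ^ (Nat.log 2 m / 2 + Nat.log 2 m / 2) := (pow_add _ _ _).symm
    _ ≤ 2 ^ Nat.log 2 m := Nat.pow_le_pow_right two_pos (by omega)
    _ ≤ m := Nat.pow_log_le_self 2 hm

lemma tendsto_groupCount {n : ℕ} (hn : 0 < n) : Tendsto (groupCount n) atTop atTop := by
  refine tendsto_atTop.2 fun B => ?_
  filter_upwards [tendsto_groupSize.eventually_ge_atTop (n * B),
    eventually_ne_atTop 0] with m hm hm0
  rw [groupCount, Nat.le_div_iff_mul_le (Nat.mul_pos hn (groupSize_pos m))]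
  calc B * (n * groupSize m) = (n * B) * groupSize m := by ring
    _ ≤ groupSize m * groupSize m := Nat.mul_le_mul_right _ hm
    _ ≤ m := groupSize_mul_self_le hm0

lemma exists_pi_eventually {ι : Type*} {l : Filter ι} {α : ι → Type*} [∀ i, Nonempty (α i)]
    {p : ∀ i, α i → Prop} (h : ∀ᶠ i in l, ∃ x, p i x) : ∃ x : ∀ i, α i, ∀ᶠ i in l, p i (x i) :=
  ⟨fun i => Classical.epsilon (p i), h.mono fun _ => Classical.epsilon_spec⟩

namespace CodingScheme

variable {V : Type*} {L : ℕ} {N : UnicastNetwork V L} {P : ℝ} {n : ℕ} {R : Fin L → ℝ}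

lemma rate_nonneg (C : CodingScheme N P n R) (hn : 0 < n) (i : Fin L) : 0 ≤ R i := by
  have hcard : (1 : ℝ) ≤ 2 ^ (n * R i) := Nat.floor_pos.1 (Fin.pos (C.dec i 0))
  rw [← Real.rpow_zero 2, Real.rpow_le_rpow_left_iff one_lt_two] at hcard
  exact nonneg_of_mul_nonneg_right hcard (Nat.cast_pos.2 hn)

lemma nonempty_of_rate_nonneg (C : CodingScheme N P n R) (m : ℕ) {R' : Fin L → ℝ}
    (hR' : ∀ i, 0 ≤ R' i) : Nonempty (CodingScheme N P m R') :=
  have := fun i => messageSet_nonempty (n := m) (hR' i)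
  ⟨C.interleave (Schedule.lexicographic (k := 0) (b := 1) ((zero_mul _).trans_le m.zero_le))
    (Q := 1) (by simp) (fun _ _ q => q.1.elim0) fun _ _ => Classical.ofNonempty⟩

variable [Fintype V]

lemma errorProb_nonneg (C : CodingScheme N P n R) (ν : V → Measure ℝ) : 0 ≤ C.errorProb ν :=
  div_nonneg (Finset.sum_nonneg fun _ _ => measureReal_nonneg) (Nat.cast_nonneg _)

theorem exists_errorProb_le (C : CodingScheme N P n R) (hn : 0 < n) {η : ℝ} (hη : 0 < η)
    (hη' : η ≤ 1 / 2) (hnR : ∀ i, R i = 0 ∨ 12 ≤ η * (n * R i)) {δ : ℝ} (hδ : 2 ^ L * δ < η / 8)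
    {m : ℕ} (hk : 16 ≤ groupCount n m) (hkη : 2 ≤ η * groupCount n m) :
    ∃ D : CodingScheme N P m fun i => (1 - η) * R i,
      ∀ ν : V → Measure ℝ, (∀ v, IsProbabilityMeasure (ν v)) →
        (∀ a : Fin (groupSize m) → ℝ, ∑ j, a j ^ 2 = 1 → (∀ j, |a j| = (√(groupSize m))⁻¹) →
          C.errorProb (fun v => weightedSumLaw (ν v) a) ≤ δ) →
        D.errorProb ν ≤ 2 ^ L / (groupCount n m * (η / 8 - 2 ^ L * δ) ^ 2) := by
  obtain ⟨Q, hQ, hentry⟩ : ∃ Q : Matrix (Fin (groupSize m)) (Fin (groupSize m)) ℝ,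
      Q * Qᵀ = 1 ∧ ∀ i j, |Q i j| = (√(groupSize m))⁻¹ :=
    exists_mul_transpose_eq_one_and_abs_apply_eq (Nat.log 2 m / 2)
  have hrow : ∀ i, ∑ j, Q i j ^ 2 = 1 := fun i => by
    simpa [Matrix.mul_apply, sq] using congrFun (congrFun hQ i) i
  have hcodes := fun i => nonempty_outerCode_messageSet (C.rate_nonneg hn i) hη hη' (hnR i) hk hkη
    (groupSize_pos m) (groupCount_mul_le n m) (le_groupCount_add_one_mul hn m)
    (Nat.floor_le (by positivity))
  have : Nontrivial (Fin (groupCount n m)) := Fin.nontrivial_iff_two_le.2 (by omega)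
  have : Nonempty (Fin (groupSize m)) := Fin.pos_iff_nonempty.1 (groupSize_pos m)
  refine ⟨C.interleaveCodes (Schedule.lexicographic (groupCount_mul_le n m)) hQ fun i =>
    (hcodes i).some, fun ν _ hν => ?_⟩
  have hbound := C.errorProb_interleaveCodes_le (Schedule.lexicographic (groupCount_mul_le n m))
    (fun i => (hcodes i).some) hQ (fun j => hν (Q j) (hrow j) (hentry j)) hδ (by
      rw [Fintype.card_prod, Fintype.card_fin, Fintype.card_fin, Nat.cast_mul]
      exact (Nat.lt_floor_add_one _).le)
  rwa [Fintype.card_fin] at hbound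

theorem HasReadingPrecision.exists_forall_achieves {C : CodingScheme N P n R} {ρ : ℕ}
    (hC : C.HasReadingPrecision ρ) (hn : 0 < n) {η : ℝ} (hη : 0 < η) (hη' : η ≤ 1 / 2)
    (hnR : ∀ i, R i = 0 ∨ 12 ≤ η * (n * R i)) {σsq : V → ℝ≥0}
    (herror : 2 ^ L * C.errorProb (awgn σsq) < η / 8) :
    ∃ D : (m : ℕ+) → CodingScheme N P m fun i => (1 - η) * R i,
      ∀ ν : V → Measure ℝ, (∀ v, IsNoiseLaw (ν v) (σsq v)) → Achieves D ν := by
  obtain ⟨δ, hδ, hδη⟩ := exists_between ((lt_div_iff₀' (by positivity)).2 herror)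
  replace hδη := (lt_div_iff₀' (by positivity)).1 hδη
  have hcount : Tendsto (fun m : ℕ+ => groupCount n m) atTop atTop :=
    (tendsto_groupCount hn).comp tendsto_PNat_val_atTop_atTop
  have hcount' : Tendsto (fun m : ℕ+ => (groupCount n m : ℝ)) atTop atTop :=
    tendsto_natCast_atTop_atTop.comp hcount
  have hsize : Tendsto (fun m : ℕ+ => (√(groupSize m))⁻¹) atTop (𝓝 0) :=
    tendsto_inv_atTop_zero.comp (Real.tendsto_sqrt_atTop.comp (tendsto_natCast_atTop_atTop.comp
      (tendsto_groupSize.comp tendsto_PNat_val_atTop_atTop)))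
  have hbound : Tendsto (fun m : ℕ+ =>
      2 ^ L / (groupCount n m * (η / 8 - 2 ^ L * δ) ^ 2)) atTop (𝓝 0) :=
    tendsto_const_nhds.div_atTop (hcount'.atTop_mul_const (pow_pos (sub_pos.2 hδη) 2))
  have hD := ((hcount.eventually_ge_atTop 16).and
    ((hcount'.const_mul_atTop hη).eventually_ge_atTop 2)).mono fun m hm =>
      C.exists_errorProb_le hn hη hη' hnR hδη hm.1 hm.2
  have := fun m : ℕ+ => C.nonempty_of_rate_nonneg m (R' := fun i => (1 - η) * R i) fun i =>
    mul_nonneg (by linarith) (C.rate_nonneg hn i)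
  obtain ⟨D, hD⟩ := exists_pi_eventually hD
  refine ⟨D, fun ν hν => ?_⟩
  obtain ⟨r, hr, hsmall⟩ := hC.exists_forall_errorProb_weightedSumLaw_lt hδ hν
  refine squeeze_zero' (Eventually.of_forall fun m => (D m).errorProb_nonneg ν) ?_ hbound
  filter_upwards [hD, hsize.eventually_le_const hr] with m hm hmr
  exact hm ν (fun v => (hν v).isProbabilityMeasure) fun a ha ha' =>
    (hsmall _ a ha fun j => (ha' j).trans_le hmr).le

end CodingScheme

lemma exists_rate_loss {L : ℕ} (R : Fin L → ℝ) {ε : ℝ} (hε : 0 < ε) :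
    ∃ η : ℝ, 0 < η ∧ η ≤ 1 / 2 ∧ ∀ i, |(1 - η) * R i - R i| < ε := by
  have hsmall : ∀ᶠ η : ℝ in 𝓝 0, η < 1 / 2 ∧ ∀ i, |(1 - η) * R i - R i| < ε := by
    refine (eventually_lt_nhds (by norm_num)).and (eventually_all.2 fun i => ?_)
    have hcont : Continuous fun η : ℝ => |(1 - η) * R i - R i| := by fun_prop
    exact (hcont.tendsto' 0 0 (by simp)).eventually_lt_const hε
  obtain ⟨η, ⟨hη', hR⟩, hη⟩ :=
    ((hsmall.filter_mono nhdsWithin_le_nhds).and self_mem_nhdsWithin).exists (f := 𝓝[>] 0)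
  exact ⟨η, hη, hη'.le, hR⟩

lemma eventually_eq_zero_or_le_mul {L : ℕ} {R : Fin L → ℝ} (hR : ∀ i, 0 ≤ R i) {η : ℝ} (hη : 0 < η)
    (c : ℝ) : ∀ᶠ n : ℕ+ in atTop, ∀ i, R i = 0 ∨ c ≤ η * ((n : ℕ) * R i) := by
  refine eventually_all.2 fun i => ?_
  rcases (hR i).eq_or_lt with h | h
  · exact Eventually.of_forall fun _ => Or.inl h.symm
  · have hn : Tendsto (fun n : ℕ+ => η * ((n : ℕ) * R i)) atTop atTop :=
      ((tendsto_natCast_atTop_atTop.comp tendsto_PNat_val_atTop_atTop).atTop_mul_const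
        h).const_mul_atTop hη
    exact (hn.eventually_ge_atTop c).mono fun _ => Or.inr

theorem theorem2 {V : Type*} [Fintype V] {L : ℕ} (N : UnicastNetwork V L) (P : ℝ)
    (σsq : V → ℝ≥0) (R : Fin L → ℝ)
    (hR : AchievableWithFinitePrecision N P (awgn σsq) R) :
    ∀ ε : ℝ, 0 < ε → ∃ R' : Fin L → ℝ, (∀ i, |R' i - R i| < ε) ∧
      ∃ C : (n : ℕ+) → CodingScheme N P n R',
        ∀ ν : V → Measure ℝ, (∀ v, IsNoiseLaw (ν v) (σsq v)) → Achieves C ν := by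
  intro ε hε
  obtain ⟨C, ρ, hC, hach⟩ := hR
  obtain ⟨η, hη, hη', hε⟩ := exists_rate_loss R hε
  have herror : ∀ᶠ n in atTop, 2 ^ L * (C n).errorProb (awgn σsq) < η / 8 :=
    (hach.const_mul _).eventually_lt_const (by rw [mul_zero]; positivity)
  obtain ⟨n, hn, hnR⟩ :=
    (herror.and (eventually_eq_zero_or_le_mul ((C 1).rate_nonneg one_pos) hη 12)).exists
  exact ⟨_, hε, (hC n).2.exists_forall_achieves n.pos hη hη' hnR hn⟩
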